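/- **Theorem.** Outcome determination for the reversal scoring procedure is solvable in polynomial time when the integrity constraint is a DNNF circuit. That is, the following problem is decidable by a deterministic algorithm in time polynomial in the size of the instance. *Instance:* a finite set $\mathcal I=\{x_1,\dots,x_n\}$ of issues (propositional variables); a DNNF circuit $\Gamma$, whose variables may include $x_1,\dots,x_n$; a profile $\boldsymbol r=(r_1,\dots,r_p)$, $p\ge 1$, of rational ballots; and a partial ballot $s\in\{0,1,\star\}^n$. *Question:* is there a ballot $r^*\in F_{\mathrm R}(\boldsymbol r)$ such that $s$ agrees with $r^*$, i.e. $s(x)=r^*(x)$ for every $x\in\mathcal I$ with $s(x)\ne\star$? Here a *DNNF circuit* is a directed acyclic graph with a single root (node without ingoing arcs) whose leaves are labelled with $\top$, $\bot$, $x$ or $\neg x$ for a propositional variable $x$ and whose internal nodes are labelled with $\wedge$ or $\vee$, such that the subcircuits rooted at any two different children of an $\wedge$-node have no variable in common; its truth value under an assignment is the value of its root. A *ballot* is a function $r:\mathcal I\to\{0,1\}$, extended to literals by $r(\neg x)=1-r(x)$. It is *rational* if it is consistent with $\Gamma$, i.e. if it extends to a truth assignment of all variables that satisfies $\Gamma$;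 $\mathcal R$ denotes the set of rational ballots. With $d_{\mathrm H}(r,r')=|\{x\in\mathcal I: r(x)\neq r'(x)\}|$, the *reversal score* of a literal $l\in\mathrm{Lit}(\mathcal I)=\{x,\neg x: x\in\mathcal I\}$ with respect to $r\in\mathcal R$ is $$s_{\mathrm R}(r,l)=\min\{d_{\mathrm H}(r,r') : r'\in\mathcal R,\ r'(l)=0\},$$ (with value $0$ if no such $r'$ exists; replacing this $0$ by another natural number does not change $F_{\mathrm R}$), and the *reversal scoring procedure* is $$F_{\mathrm R}(\boldsymbol r)=\operatorname*{argmax}_{r\in\mathcal R}\ \sum_{i=1}^{p}\ \sum_{l\in\mathrm{Lit}(\mathcal I),\ r(l)=1} s_{\mathrm R}(r_i,l).$$ Polynomial time means: there are one program for a random access machine with logarithmic cost and one polynomial $T$ such that on every instance, given as a list of natural numbers of total binary length $N$, the program halts within time $T(N)$ with the correct answer. -/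

import Mathlib

/-! ### Polynomial time: the random access machine with logarithmic cost -/

namespace RAM

/-- A memory state: registers `reg 0, reg 1, …` and arrays `arr 0, arr 1, …`, all of whose cells
hold natural numbers.  A program refers to finitely many registers and arrays only. -/
structure State where
  reg : ℕ → ℕ
  arr : ℕ → ℕ → ℕ

/-- The basic instructions. -/
inductive Instr where
  /-- `reg d := c` -/
  | const (d c : ℕ)
  /-- `reg d := reg a + reg b` -/
  | add (d a b : ℕ)
  /-- `reg d := reg a - reg b`, which is `0` if `reg a < reg b` -/
  | sub (d a b : ℕ)
  /-- `reg d := arr k [reg a]` -/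
  | load (d k a : ℕ)
  /-- `arr k [reg a] := reg b` -/
  | store (k a b : ℕ)

/-- The effect of a basic instruction. -/
def Instr.run : Instr → State → State
  | .const d c, σ => { σ with reg := Function.update σ.reg d c }
  | .add d a b, σ => { σ with reg := Function.update σ.reg d (σ.reg a + σ.reg b) }
  | .sub d a b, σ => { σ with reg := Function.update σ.reg d (σ.reg a - σ.reg b) }
  | .load d k a, σ => { σ with reg := Function.update σ.reg d (σ.arr k (σ.reg a)) }
  | .store k a b, σ =>
      { σ with arr := Function.update σ.arr k (Function.update (σ.arr k) (σ.reg a) (σ.reg b)) }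

/-- The logarithmic cost of a basic instruction: one plus the number of binary digits of all the
operands (values and addresses) that it handles. -/
def Instr.cost : Instr → State → ℕ
  | .const _ c, _ => 1 + Nat.size c
  | .add _ a b, σ => 1 + Nat.size (σ.reg a) + Nat.size (σ.reg b)
  | .sub _ a b, σ => 1 + Nat.size (σ.reg a) + Nat.size (σ.reg b)
  | .load _ k a, σ => 1 + Nat.size (σ.reg a) + Nat.size (σ.arr k (σ.reg a))
  | .store _ a b, σ => 1 + Nat.size (σ.reg a) + Nat.size (σ.reg b)

/-- Programs. Conditions compare two registers: `reg a < reg b`. -/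
inductive Prog where
  | skip
  | instr (i : Instr)
  | seq (p q : Prog)
  | ite (a b : ℕ) (p q : Prog)
  | while (a b : ℕ) (p : Prog)

/-- The cost of evaluating the condition `reg a < reg b`. -/
def testCost (a b : ℕ) (σ : State) : ℕ := 1 + Nat.size (σ.reg a) + Nat.size (σ.reg b)

/-- `Exec p σ t τ`: started in the state `σ`, the program `p` halts in the state `τ`, after a
computation of total logarithmic cost `t`. -/
inductive Exec : Prog → State → ℕ → State → Prop
  | skip (σ : State) : Exec .skip σ 1 σ
  | instr (i : Instr) (σ : State) : Exec (.instr i) σ (i.cost σ) (i.run σ)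
  | seq {p q : Prog} {σ τ ρ : State} {t u : ℕ} :
      Exec p σ t τ → Exec q τ u ρ → Exec (.seq p q) σ (t + u) ρ
  | iteTrue {a b : ℕ} {p q : Prog} {σ τ : State} {t : ℕ} :
      σ.reg a < σ.reg b → Exec p σ t τ → Exec (.ite a b p q) σ (testCost a b σ + t) τ
  | iteFalse {a b : ℕ} {p q : Prog} {σ τ : State} {t : ℕ} :
      ¬ σ.reg a < σ.reg b → Exec q σ t τ → Exec (.ite a b p q) σ (testCost a b σ + t) τ
  | whileTrue {a b : ℕ} {p : Prog} {σ τ ρ : State} {t u : ℕ} :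
      σ.reg a < σ.reg b → Exec p σ t τ → Exec (.while a b p) τ u ρ →
      Exec (.while a b p) σ (testCost a b σ + t + u) ρ
  | whileFalse {a b : ℕ} {p : Prog} {σ : State} :
      ¬ σ.reg a < σ.reg b → Exec (.while a b p) σ (testCost a b σ) σ

/-- The initial state on the input word `w`: array `0` holds `w`, register `0` holds the length of
`w`, and everything else is `0`. -/
def init (w : List ℕ) : State where
  reg := fun i => if i = 0 then w.length else 0
  arr := fun k j => if k = 0 then w.getD j 0 else 0

/-- The size of an input word: the number of binary digits of its entries, plus one per entry. -/
def inputSize (w : List ℕ) : ℕ := (w.map fun a => Nat.size a + 1).sum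

/-- The decision problem with set of instances `ι`, written down as words by `enc`, and with set of
yes-instances `yes`, is solvable in polynomial time: there are a single program and a single
polynomial `T` such that on (the encoding of) every instance the program halts within time
`T (size of the input)` and leaves the answer (`1` for yes, `0` for no) in register `0`. -/
def DecidableInPolyTime {ι : Type*} (enc : ι → List ℕ) (yes : ι → Prop) : Prop :=
  ∃ (p : Prog) (T : Polynomial ℕ), ∀ i : ι, ∃ (t : ℕ) (τ : State),
    Exec p (init (enc i)) t τ ∧ t ≤ T.eval (inputSize (enc i)) ∧
    (yes i → τ.reg 0 = 1) ∧ (¬ yes i → τ.reg 0 = 0)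

end RAM

/-! ### Boolean circuits in decomposable negation normal form -/

/-- Labels of the nodes of a circuit, together with the list of children for an internal node.
Variables are natural numbers; `lit x true` is `x` and `lit x false` is `¬ x`. -/
inductive NodeLabel (V : Type) where
  | top
  | bot
  | lit (x : ℕ) (b : Bool)
  | and (children : List V)
  | or (children : List V)

/-- The children of a node with the given label. -/
def NodeLabel.children {V : Type} : NodeLabel V → List V
  | .and cs => cs
  | .or cs => cs
  | _ => []

/-- A finite directed graph with labelled nodes and a designated node `root`. -/
structure Circuit where
  numNodes : ℕ
  root : Fin numNodes
  label : Fin numNodes → NodeLabel (Fin numNodes)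

namespace Circuit

variable (C : Circuit)

/-- There is an arc from `i` to `j`, that is, `j` is a child of `i`. -/
def Arc (i j : Fin C.numNodes) : Prop := j ∈ (C.label i).children

/-- `C` is a Boolean circuit in negation normal form: a directed acyclic graph whose only node
without ingoing arcs is `root`, and in which every node labelled with `∧` or `∨` is internal
(nodes with other labels are leaves by construction). -/
structure IsNNF : Prop where
  acyclic : ∀ i, ¬ Relation.TransGen C.Arc i i
  root_unique : ∀ i, (∀ j, ¬ C.Arc j i) ↔ i = C.root
  children_nodup : ∀ i, (C.label i).children.Nodup
  and_internal : ∀ i cs, C.label i = .and cs → cs ≠ []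
  or_internal : ∀ i cs, C.label i = .or cs → cs ≠ []

/-- The variables that occur in the subcircuit with root `i`. -/
def varsAt (i : Fin C.numNodes) : Set ℕ :=
  {x | ∃ j b, Relation.ReflTransGen C.Arc i j ∧ C.label j = .lit x b}

/-- `C` is a DNNF circuit: it is in negation normal form, and any two different children of a node
that is labelled with `∧` are the roots of subcircuits without common variables. -/
structure IsDNNF : Prop extends C.IsNNF where
  decomposable : ∀ i cs, C.label i = .and cs → ∀ d₁ ∈ cs, ∀ d₂ ∈ cs, d₁ ≠ d₂ →
    Disjoint (C.varsAt d₁) (C.varsAt d₂)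

/-- `C.Holds α i`: the node `i` gets the value true under the truth assignment `α`. For an acyclic
`C` the inductive definition is the usual bottom-up evaluation, see `Circuit.holds_iff`. -/
inductive Holds (α : ℕ → Bool) : Fin C.numNodes → Prop
  | top {i} : C.label i = .top → Holds α i
  | lit {i x b} : C.label i = .lit x b → α x = b → Holds α i
  | and {i cs} : C.label i = .and cs → (∀ j ∈ cs, Holds α j) → Holds α i
  | or {i cs} (j) : C.label i = .or cs → j ∈ cs → Holds α j → Holds α i

theorem holds_iff (α : ℕ → Bool) (i : Fin C.numNodes) :
    C.Holds α i ↔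
      match C.label i with
      | .top => True
      | .bot => False
      | .lit x b => α x = b
      | .and cs => ∀ j ∈ cs, C.Holds α j
      | .or cs => ∃ j ∈ cs, C.Holds α j := by
  constructor
  · intro h
    cases h with
    | top h => simp [h]
    | lit h h' => simpa [h] using h'
    | and h h' => simpa [h] using h'
    | or j h h' h'' => simpa [h] using ⟨j, h', h''⟩
  · intro h
    cases hl : C.label i with
    | top => exact .top hl
    | bot => simp [hl] at h
    | lit x b => exact .lit hl (by simpa [hl] using h)
    | and cs => exact .and hl (by simpa [hl] using h)
    | or cs =>
      obtain ⟨j, hj, hj'⟩ : ∃ j ∈ cs, C.Holds α j := by simpa [hl] using h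
      exact .or j hl hj hj'

/-- The truth value of the circuit is the one of its root. -/
def Sat (α : ℕ → Bool) : Prop := C.Holds α C.root

end Circuit

/-! ### Judgment aggregation -/

/-- Ballots for the issues `x_0, …, x_{n-1}`. -/
abbrev Ballot (n : ℕ) : Type := Fin n → Bool

/-- Partial ballots; `none` stands for `⋆`. -/
abbrev PartialBallot (n : ℕ) : Type := Fin n → Option Bool

/-- The partial ballot `s` agrees with the ballot `r`. -/
def PartialBallot.Agrees {n : ℕ} (s : PartialBallot n) (r : Ballot n) : Prop :=
  ∀ x, s x ≠ none → s x = some (r x)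

/-- Literals over the issues: `(x, true)` is `x` and `(x, false)` is `¬ x`. -/
abbrev IssueLit (n : ℕ) : Type := Fin n × Bool

/-- The truth value `r(l)` of the literal `l` under the ballot `r`. -/
def Ballot.val {n : ℕ} (r : Ballot n) (l : IssueLit n) : Bool := r l.1 == l.2

/-- The rational ballots: those that are consistent with the integrity constraint `Γ`. The issues
are the variables `0, …, n-1`; other variables may occur in `Γ`, and then consistency means that
the ballot can be extended to a truth assignment that satisfies `Γ`. -/
def rationalBallots (n : ℕ) (Γ : Circuit) : Set (Ballot n) :=
  {r | ∃ α : ℕ → Bool, (∀ x : Fin n, α x = r x) ∧ Γ.Sat α}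

/-- The cumulative score of the ballot `r` for the profile `prof`. -/
def totalScore {n : ℕ} (s : Ballot n → IssueLit n → ℕ) (prof : List (Ballot n)) (r : Ballot n) :
    ℕ :=
  (prof.map fun r' => ∑ l : IssueLit n with r.val l = true, s r' l).sum

/-- The scoring procedure of the scoring function `s`, where `R` is the set of rational ballots. -/
def scoringProcedure {n : ℕ} (R : Set (Ballot n)) (s : Ballot n → IssueLit n → ℕ)
    (prof : List (Ballot n)) : Set (Ballot n) :=
  {r | r ∈ R ∧ ∀ r' ∈ R, totalScore s prof r' ≤ totalScore s prof r}

/-- The reversal score of `l` with respect to `r`: the least Hamming distance from `r` to a rational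
ballot that makes `l` false. If there is no such ballot, then the value is `0`; such a literal is
true in all rational ballots, so that any other natural number, fixed for the literal, would give
the same scoring procedure. -/
noncomputable def reversalScore {n : ℕ} (R : Set (Ballot n)) (r : Ballot n) (l : IssueLit n) : ℕ :=
  sInf {d | ∃ r' ∈ R, r'.val l = false ∧ hammingDist r r' = d}

/-- The reversal scoring procedure. -/
noncomputable def reversalScoring {n : ℕ} (R : Set (Ballot n)) (prof : List (Ballot n)) :
    Set (Ballot n) :=
  scoringProcedure R (reversalScore R) prof

/-! ### Outcome determination -/

/-- An instance of outcome determination whose integrity constraint is a DNNF circuit. -/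
structure DNNFInstance where
  /-- the number of issues -/
  n : ℕ
  Γ : Circuit
  isDNNF : Γ.IsDNNF
  profile : List (Ballot n)
  profile_ne_nil : profile ≠ []
  profile_rational : ∀ r ∈ profile, r ∈ rationalBallots n Γ
  s : PartialBallot n

namespace DNNFInstance

def encodeLabel {N : ℕ} : NodeLabel (Fin N) → List ℕ
  | .top => [0]
  | .bot => [1]
  | .lit x true => [2, x]
  | .lit x false => [3, x]
  | .and cs => 4 :: cs.length :: cs.map Fin.val
  | .or cs => 5 :: cs.length :: cs.map Fin.val

def encodeCircuit (C : Circuit) : List ℕ :=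
  C.numNodes :: C.root.val :: (List.finRange C.numNodes).flatMap fun i => encodeLabel (C.label i)

def encodeBallot {n : ℕ} (r : Ballot n) : List ℕ :=
  (List.finRange n).map fun x => (r x).toNat

def encodePartialBallot {n : ℕ} (s : PartialBallot n) : List ℕ :=
  (List.finRange n).map fun x =>
    match s x with
    | some b => b.toNat
    | none => 2

/-- The instance as an input word: the number of issues, the circuit, the number of ballots, the
ballots, and the partial ballot. -/
def encode (I : DNNFInstance) : List ℕ :=
  I.n :: (encodeCircuit I.Γ ++
    (I.profile.length :: (I.profile.flatMap encodeBallot ++ encodePartialBallot I.s)))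

/-- The question: is there an outcome of the reversal scoring procedure with which `s` agrees? -/
def IsYes (I : DNNFInstance) : Prop :=
  ∃ r ∈ reversalScoring (rationalBallots I.n I.Γ) I.profile, I.s.Agrees r

end DNNFInstance

/-!
A ballot of maximal total score minimizes the total weight of the literals that it makes false, and
a reversal score is a least Hamming distance to a rational ballot with a prescribed literal.  Both
are instances of one optimization problem: given a cost for each literal over the issues, find the
least cost of a model of the circuit.  For the reversal score of a literal that is true in `r`, that
literal gets the cost `n + 1`, which exceeds all Hamming distances (`reversalScore_of_val_eq`).
To include the partial ballot `s`, one adds cost `1` to every literal that contradicts `s`; then the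
minimum stays the same if and only if some optimal ballot agrees with `s` (`exists_agrees_iff`).

In a DNNF circuit the least cost is computed node by node: costs add up at a conjunction, by
decomposability, and a disjunction takes the minimum (`Circuit.isLeastCost_nodeCost`).  Replacing
the cost of a literal by its excess over the complementary literal makes variables that do not occur
below a node irrelevant.  The nodes need not be listed bottom-up; as many passes over all nodes as
there are nodes yield the right values (`run_minCost`).

The algorithm is written in a small imperative language whose loops have a number of rounds that is
fixed on entry and at most the length of the input, so that the number of steps is polynomial for
syntactic reasons (`RAM.Cmd.compile_spec`).  The machine cannot multiply, hence numbers get at most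
one digit longer with every step, and a polynomial number of steps has polynomial logarithmic cost
(`RAM.RunsIn`).
-/

namespace RAM

/-! ### Counting steps instead of digits -/

/-- All numbers in the memory have at most `L` binary digits. -/
def State.Bounded (L : ℕ) (σ : State) : Prop :=
  (∀ i, Nat.size (σ.reg i) ≤ L) ∧ ∀ k j, Nat.size (σ.arr k j) ≤ L

theorem State.Bounded.mono {L L' : ℕ} {σ : State} (h : σ.Bounded L) (hL : L ≤ L') :
    σ.Bounded L' :=
  ⟨fun i => (h.1 i).trans hL, fun k j => (h.2 k j).trans hL⟩

/-- `RunsIn p σ k τ`: the program `p` takes `σ` to `τ` in at most `k` steps.  As there is no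
multiplication, a step makes the numbers in the memory at most one digit longer, so that the
logarithmic cost is controlled by the number of steps and the number `L` of digits at the start.
Loading a constant counts with its number of digits. -/
def RunsIn (p : Prog) (σ : State) (k : ℕ) (τ : State) : Prop :=
  ∃ t, Exec p σ t τ ∧ ∀ L, σ.Bounded L → τ.Bounded (L + k) ∧ t ≤ k * (1 + 2 * (L + k))

theorem RunsIn.mono {p : Prog} {σ τ : State} {k k' : ℕ} (h : RunsIn p σ k τ) (hk : k ≤ k') :
    RunsIn p σ k' τ := by
  obtain ⟨t, ht, H⟩ := h
  refine ⟨t, ht, fun L hL => ⟨(H L hL).1.mono (by omega), (H L hL).2.trans ?_⟩⟩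
  gcongr

theorem RunsIn.skip (σ : State) : RunsIn .skip σ 1 σ :=
  ⟨1, .skip σ, fun L hL => ⟨hL.mono (by omega), by omega⟩⟩

theorem size_add_le {a b L : ℕ} (ha : Nat.size a ≤ L) (hb : Nat.size b ≤ L) :
    Nat.size (a + b) ≤ L + 1 := by
  rw [Nat.size_le] at *
  rw [pow_succ]
  omega

theorem State.Bounded.setReg {L k : ℕ} {σ : State} (h : σ.Bounded L) {d v : ℕ}
    (hv : Nat.size v ≤ L + k) :
    State.Bounded (L + k) { σ with reg := Function.update σ.reg d v } := by
  refine ⟨fun i => ?_, fun k j => (h.2 k j).trans (by omega)⟩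
  simp only [Function.update_apply]
  split_ifs
  · exact hv
  · exact (h.1 i).trans (by omega)

/-- The number of steps that is charged for a basic instruction.  A constant is the only source of
numbers that are not bounded in terms of the memory, and is charged for all of its digits. -/
def Instr.steps : Instr → ℕ
  | .const _ c => 1 + Nat.size c
  | _ => 1

theorem RunsIn.instr (i : Instr) (σ : State) : RunsIn (.instr i) σ i.steps (i.run σ) := by
  refine ⟨_, .instr i σ, fun L hL => ?_⟩
  cases i with
  | const d c =>
    simp only [Instr.steps, Instr.run, Instr.cost]
    exact ⟨hL.setReg (by omega), Nat.le_mul_of_pos_right _ (by omega)⟩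
  | add d a b =>
    simp only [Instr.steps, Instr.run, Instr.cost]
    have := hL.1 a
    have := hL.1 b
    exact ⟨hL.setReg (size_add_le (hL.1 a) (hL.1 b)), by omega⟩
  | sub d a b =>
    simp only [Instr.steps, Instr.run, Instr.cost]
    have h₁ := hL.1 a
    have := hL.1 b
    refine ⟨hL.setReg ?_, by omega⟩
    have := Nat.size_le_size (Nat.sub_le (σ.reg a) (σ.reg b))
    omega
  | load d k a =>
    simp only [Instr.steps, Instr.run, Instr.cost]
    have := hL.1 a
    have := hL.2 k (σ.reg a)
    exact ⟨hL.setReg (by omega), by omega⟩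
  | store k a b =>
    simp only [Instr.steps, Instr.run, Instr.cost]
    have := hL.1 a
    have := hL.1 b
    refine ⟨⟨fun i => (hL.1 i).trans (by omega), fun k' j => ?_⟩, by omega⟩
    have := hL.2 k' j
    have := hL.2 k j
    by_cases hk : k' = k
    · subst hk
      by_cases hj : j = σ.reg a
      · subst hj
        simp only [Function.update_self]
        omega
      · simp only [Function.update_self, Function.update_of_ne hj]
        omega
    · simp only [Function.update_of_ne hk]
      omega

theorem RunsIn.seq {p q : Prog} {σ τ ρ : State} {k l : ℕ} (hp : RunsIn p σ k τ)
    (hq : RunsIn q τ l ρ) : RunsIn (.seq p q) σ (k + l) ρ := by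
  obtain ⟨t, ht, H⟩ := hp
  obtain ⟨u, hu, H'⟩ := hq
  refine ⟨_, .seq ht hu, fun L hL => ?_⟩
  obtain ⟨h₁, h₂⟩ := H L hL
  obtain ⟨h₃, h₄⟩ := H' _ h₁
  refine ⟨h₃.mono (by omega), ?_⟩
  calc t + u ≤ k * (1 + 2 * (L + (k + l))) + l * (1 + 2 * (L + (k + l))) :=
        Nat.add_le_add (h₂.trans (by gcongr; omega)) (h₄.trans (by gcongr 3; omega))
    _ = _ := by ring

theorem testCost_le {a b : ℕ} {σ : State} {L : ℕ} (hL : σ.Bounded L) :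
    testCost a b σ ≤ 1 + 2 * L := by
  have := hL.1 a
  have := hL.1 b
  simp only [testCost]
  omega

theorem RunsIn.iteTrue {a b : ℕ} {p q : Prog} {σ τ : State} {k : ℕ} (h : σ.reg a < σ.reg b)
    (hp : RunsIn p σ k τ) : RunsIn (.ite a b p q) σ (1 + k) τ := by
  obtain ⟨t, ht, H⟩ := hp
  refine ⟨_, .iteTrue h ht, fun L hL => ⟨(H L hL).1.mono (by omega), ?_⟩⟩
  have h₁ := (H L hL).2
  have h₂ : testCost a b σ ≤ _ := testCost_le hL
  nlinarith

theorem RunsIn.iteFalse {a b : ℕ} {p q : Prog} {σ τ : State} {k : ℕ} (h : ¬ σ.reg a < σ.reg b)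
    (hq : RunsIn q σ k τ) : RunsIn (.ite a b p q) σ (1 + k) τ := by
  obtain ⟨t, ht, H⟩ := hq
  refine ⟨_, .iteFalse h ht, fun L hL => ⟨(H L hL).1.mono (by omega), ?_⟩⟩
  have h₁ := (H L hL).2
  have h₂ : testCost a b σ ≤ _ := testCost_le hL
  nlinarith

theorem RunsIn.whileFalse {a b : ℕ} {p : Prog} {σ : State} (h : ¬ σ.reg a < σ.reg b) :
    RunsIn (.while a b p) σ 1 σ := by
  refine ⟨_, .whileFalse h, fun L hL => ⟨hL.mono (by omega), ?_⟩⟩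
  have : testCost a b σ ≤ _ := testCost_le hL
  omega

theorem RunsIn.whileTrue {a b : ℕ} {p : Prog} {σ τ ρ : State} {k l : ℕ}
    (h : σ.reg a < σ.reg b) (hp : RunsIn p σ k τ) (hw : RunsIn (.while a b p) τ l ρ) :
    RunsIn (.while a b p) σ (1 + k + l) ρ := by
  obtain ⟨t, ht, H⟩ := hp
  obtain ⟨u, hu, H'⟩ := hw
  refine ⟨_, .whileTrue h ht hu, fun L hL => ?_⟩
  obtain ⟨h₁, h₂⟩ := H L hL
  obtain ⟨h₃, h₄⟩ := H' _ h₁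
  refine ⟨h₃.mono (by omega), ?_⟩
  have h₅ : testCost a b σ ≤ _ := testCost_le hL
  calc testCost a b σ + t + u
      ≤ (1 + 2 * (L + (1 + k + l))) + k * (1 + 2 * (L + (1 + k + l))) +
        l * (1 + 2 * (L + (1 + k + l))) :=
        Nat.add_le_add (Nat.add_le_add (h₅.trans (by omega)) (h₂.trans (by gcongr 3; omega)))
          (h₄.trans (by gcongr 3; omega))
    _ = _ := by ring

/-! ### A small imperative language with bounded loops -/

/-- Expressions over variables `V` and arrays `A`. -/
inductive Expr (V A : Type) where
  | lit (c : ℕ)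
  | var (v : V)
  | get (a : A) (e : Expr V A)
  | add (e f : Expr V A)
  | sub (e f : Expr V A)

/-- Commands.  The command `loop i e c` executes `c` for `i = 0, 1, …`; the number of rounds is the
value of `e` when the loop is entered, or the length of the input word if that is smaller.  No
command can make a loop that has been entered run longer, so every command runs in polynomial
time. -/
inductive Cmd (V A : Type) where
  | skip
  | assign (v : V) (e : Expr V A)
  | store (a : A) (e f : Expr V A)
  | seq (c d : Cmd V A)
  | ite (e f : Expr V A) (c d : Cmd V A)
  | loop (i : V) (e : Expr V A) (c : Cmd V A)

/-- The values of the variables and the arrays. -/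
structure Store (V A : Type) where
  var : V → ℕ
  arr : A → ℕ → ℕ

section Language

variable {V A : Type}

/-- The value of an expression. -/
def Expr.eval (s : Store V A) : Expr V A → ℕ
  | .lit c => c
  | .var v => s.var v
  | .get a e => s.arr a (e.eval s)
  | .add e f => e.eval s + f.eval s
  | .sub e f => e.eval s - f.eval s

/-- The number of steps that the evaluation of an expression takes. -/
def Expr.steps : Expr V A → ℕ
  | .lit c => 1 + Nat.size c
  | .var _ => 2
  | .get _ e => e.steps + 1
  | .add e f => e.steps + f.steps + 1
  | .sub e f => e.steps + f.steps + 1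

/-- A bound, in the length of the input word, for the number of steps that a command takes. -/
noncomputable def Cmd.stepBound : Cmd V A → Polynomial ℕ
  | .skip => 1
  | .assign _ e => .C (e.steps + 2)
  | .store _ e f => .C (e.steps + f.steps + 1)
  | .seq c d => c.stepBound + d.stepBound
  | .ite e f c d => .C (e.steps + f.steps + 1) + (c.stepBound + d.stepBound)
  | .loop _ e c => .C (e.steps + 8) + .X * (c.stepBound + .C 6)

variable [DecidableEq V] [DecidableEq A]

/-- Assign `c` to the variable `v`. -/
def Store.setVar (s : Store V A) (v : V) (c : ℕ) : Store V A :=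
  { s with var := Function.update s.var v c }

/-- Write `c` into the cell `j` of the array `a`. -/
def Store.setArr (s : Store V A) (a : A) (j c : ℕ) : Store V A :=
  { s with arr := Function.update s.arr a (Function.update (s.arr a) j c) }

/-- Execute `f 0`, `f 1`, …, `f (k - 1)`, each after having set the variable `i` to the number of
the round. -/
def Store.iterate (i : V) (f : Store V A → Store V A) (s : Store V A) : ℕ → Store V A
  | 0 => s
  | k + 1 => f ((s.iterate i f k).setVar i k)

/-- The effect of a command, where `M` is the length of the input word. -/
def Cmd.run (M : ℕ) : Cmd V A → Store V A → Store V A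
  | .skip, s => s
  | .assign v e, s => s.setVar v (e.eval s)
  | .store a e f, s => s.setArr a (e.eval s) (f.eval s)
  | .seq c d, s => d.run M (c.run M s)
  | .ite e f c d, s => if e.eval s < f.eval s then c.run M s else d.run M s
  | .loop i e c, s => s.iterate i (c.run M) (min (e.eval s) M)

end Language

/-! ### Compilation to the random access machine -/

/-- Register `0` holds the length of the input word.  The registers `4 v + 4` are used for the
variables, the registers `4 d + 1` for intermediate results, the registers `4 d + 2` and `4 d + 3`
for the counter and the limit of a loop of nesting depth `d`. -/
abbrev varReg (v : ℕ) : ℕ := 4 * v + 4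
abbrev tmpReg (d : ℕ) : ℕ := 4 * d + 1
abbrev cntReg (d : ℕ) : ℕ := 4 * d + 2
abbrev limReg (d : ℕ) : ℕ := 4 * d + 3

/-- `reg d := reg a`, for `d ≠ a`. -/
def move (d a : ℕ) : Prog := .seq (.instr (.const d 0)) (.instr (.add d a d))

theorem RunsIn.move {d a : ℕ} (h : a ≠ d) (σ : State) :
    RunsIn (move d a) σ 2 { σ with reg := Function.update σ.reg d (σ.reg a) } := by
  have := (RunsIn.instr (.const d 0) σ).seq (RunsIn.instr (.add d a d) _)
  simpa [RAM.move, Instr.steps, Instr.run, h] using this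

section Compile

-- `nv` and `na` number the variables and the arrays.
variable {V A : Type} (nv : V → ℕ) (na : A → ℕ)

/-- Compute the value of an expression into the register `tmpReg d`. -/
def Expr.compile : ℕ → Expr V A → Prog
  | d, .lit c => .instr (.const (tmpReg d) c)
  | d, .var v => move (tmpReg d) (varReg (nv v))
  | d, .get a e => .seq (e.compile d) (.instr (.load (tmpReg d) (na a) (tmpReg d)))
  | d, .add e f => .seq (.seq (e.compile d) (f.compile (d + 1)))
      (.instr (.add (tmpReg d) (tmpReg d) (tmpReg (d + 1))))
  | d, .sub e f => .seq (.seq (e.compile d) (f.compile (d + 1)))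
      (.instr (.sub (tmpReg d) (tmpReg d) (tmpReg (d + 1))))

/-- The program for a command that is nested in `d` loops. -/
def Cmd.compile : ℕ → Cmd V A → Prog
  | _, .skip => .skip
  | _, .assign v e => .seq (e.compile nv na 0) (move (varReg (nv v)) (tmpReg 0))
  | _, .store a e f => .seq (.seq (e.compile nv na 0) (f.compile nv na 1))
      (.instr (.store (na a) (tmpReg 0) (tmpReg 1)))
  | d, .seq c c' => .seq (c.compile d) (c'.compile d)
  | d, .ite e f c c' => .seq (.seq (e.compile nv na 0) (f.compile nv na 1))
      (.ite (tmpReg 0) (tmpReg 1) (c.compile d) (c'.compile d))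
  | d, .loop i e c =>
      .seq (.seq (.seq (.seq (e.compile nv na 0) (move (limReg d) (tmpReg 0)))
        (.ite 0 (limReg d) (move (limReg d) 0) .skip)) (.instr (.const (cntReg d) 0)))
        (.while (cntReg d) (limReg d)
          (.seq (.seq (move (varReg (nv i)) (cntReg d)) (c.compile (d + 1)))
            (.seq (.instr (.const (tmpReg 0) 1))
              (.instr (.add (cntReg d) (cntReg d) (tmpReg 0))))))

/-- The memory state `σ` holds the length `M` of the input word and the store `s`. -/
structure Represents (M : ℕ) (σ : State) (s : Store V A) : Prop where
  len : σ.reg 0 = M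
  var : ∀ v, σ.reg (varReg (nv v)) = s.var v
  arr : ∀ a, σ.arr (na a) = s.arr a

variable {nv na}

/-- Only the registers for intermediate results may be overwritten freely. -/
theorem Represents.of_tmp {M : ℕ} {σ τ : State} {s : Store V A} (h : Represents nv na M σ s)
    (h₁ : ∀ r, (∀ j, r ≠ tmpReg j) → τ.reg r = σ.reg r) (h₂ : τ.arr = σ.arr) :
    Represents nv na M τ s :=
  ⟨(h₁ _ (by grind)).trans h.len, fun v => (h₁ _ (by grind)).trans (h.var v),
    fun a => by rw [h₂, h.arr]⟩

/-- The code for an expression may be used while the intermediate results with numbers below `d` are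
still needed. -/
theorem Expr.compile_spec {M : ℕ} {s : Store V A} (e : Expr V A) :
    ∀ (d : ℕ) (σ : State), Represents nv na M σ s →
      ∃ τ, RunsIn (e.compile nv na d) σ e.steps τ ∧ τ.reg (tmpReg d) = e.eval s ∧
        (∀ r, (∀ j, d ≤ j → r ≠ tmpReg j) → τ.reg r = σ.reg r) ∧ τ.arr = σ.arr := by
  induction e with
  | lit c =>
    intro d σ h
    refine ⟨_, RunsIn.instr _ σ, by simp [Instr.run, eval], fun r hr => ?_, rfl⟩
    simp [Instr.run, hr d le_rfl]
  | var v =>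
    intro d σ h
    refine ⟨_, RunsIn.move (by grind) σ, by simp [eval, h.var], fun r hr => ?_, rfl⟩
    simp [hr d le_rfl]
  | get a e ih =>
    intro d σ h
    obtain ⟨τ, h₁, h₂, h₃, h₄⟩ := ih d σ h
    refine ⟨_, h₁.seq (RunsIn.instr _ _), ?_, fun r hr => ?_, h₄⟩
    · simp [Instr.run, eval, h₂, h₄, h.arr]
    · simp [Instr.run, hr d le_rfl, h₃ r hr]
  | add e f ihe ihf =>
    intro d σ h
    obtain ⟨τ, h₁, h₂, h₃, h₄⟩ := ihe d σ h
    obtain ⟨ρ, k₁, k₂, k₃, k₄⟩ := ihf (d + 1) τ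
      (h.of_tmp (fun r hr => h₃ r fun j _ => hr j) h₄)
    refine ⟨_, (h₁.seq k₁).seq (RunsIn.instr _ _), ?_, fun r hr => ?_, k₄.trans h₄⟩
    · simp [Instr.run, eval, k₂, k₃ (tmpReg d) (by grind), h₂]
    · simp [Instr.run, hr d le_rfl, k₃ r fun j hj => hr j (by grind), h₃ r hr]
  | sub e f ihe ihf =>
    intro d σ h
    obtain ⟨τ, h₁, h₂, h₃, h₄⟩ := ihe d σ h
    obtain ⟨ρ, k₁, k₂, k₃, k₄⟩ := ihf (d + 1) τ
      (h.of_tmp (fun r hr => h₃ r fun j _ => hr j) h₄)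
    refine ⟨_, (h₁.seq k₁).seq (RunsIn.instr _ _), ?_, fun r hr => ?_, k₄.trans h₄⟩
    · simp [Instr.run, eval, k₂, k₃ (tmpReg d) (by grind), h₂]
    · simp [Instr.run, hr d le_rfl, k₃ r fun j hj => hr j (by grind), h₃ r hr]

theorem Expr.compile_pair_spec {M : ℕ} {s : Store V A} (e f : Expr V A) (σ : State)
    (h : Represents nv na M σ s) :
    ∃ τ, RunsIn (.seq (e.compile nv na 0) (f.compile nv na 1)) σ (e.steps + f.steps) τ ∧
      τ.reg (tmpReg 0) = e.eval s ∧ τ.reg (tmpReg 1) = f.eval s ∧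
      (∀ r, (∀ j, r ≠ tmpReg j) → τ.reg r = σ.reg r) ∧ Represents nv na M τ s := by
  obtain ⟨τ, h₁, h₂, h₃, h₄⟩ := e.compile_spec 0 σ h
  have hτ := h.of_tmp (fun r hr => h₃ r fun j _ => hr j) h₄
  obtain ⟨ρ, k₁, k₂, k₃, k₄⟩ := f.compile_spec 1 τ hτ
  refine ⟨ρ, h₁.seq k₁, (k₃ _ (by grind)).trans h₂, k₂, fun r hr => ?_,
    hτ.of_tmp (fun r hr => k₃ r fun j _ => hr j) k₄⟩
  rw [k₃ r fun j _ => hr j, h₃ r fun j _ => hr j]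

variable [DecidableEq V]

theorem Represents.setVar (hv : nv.Injective) {M : ℕ} {σ : State} {s : Store V A}
    (h : Represents nv na M σ s) (v : V) (c : ℕ) :
    Represents nv na M { σ with reg := Function.update σ.reg (varReg (nv v)) c }
      (s.setVar v c) := by
  refine ⟨by simp [h.len], fun v' => ?_, h.arr⟩
  by_cases hvv : v' = v
  · subst hvv
    simp [Store.setVar]
  · simp [Store.setVar, Function.update_of_ne, hvv, hv.ne hvv, h.var]

variable [DecidableEq A]

/-- Compilation is correct, and the number of steps is polynomial in the length of the input. -/
theorem Cmd.compile_spec (hv : nv.Injective) (ha : na.Injective) {M : ℕ} (c : Cmd V A) :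
    ∀ (d : ℕ) (σ : State) (s : Store V A), Represents nv na M σ s →
      ∃ τ, RunsIn (c.compile nv na d) σ (c.stepBound.eval M) τ ∧
        Represents nv na M τ (c.run M s) ∧
        ∀ j < d, τ.reg (cntReg j) = σ.reg (cntReg j) ∧ τ.reg (limReg j) = σ.reg (limReg j) := by
  induction c with
  | skip =>
    intro d σ s h
    exact ⟨σ, (RunsIn.skip σ).mono (by simp [stepBound]), h, fun _ _ => ⟨rfl, rfl⟩⟩
  | assign v e =>
    intro d σ s h
    obtain ⟨τ, h₁, h₂, h₃, h₄⟩ := e.compile_spec 0 σ h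
    have hτ := h.of_tmp (fun r hr => h₃ r fun j _ => hr j) h₄
    refine ⟨_, (h₁.seq (RunsIn.move (by grind) τ)).mono (by simp [stepBound]), ?_, fun j _ => ?_⟩
    · rw [h₂]
      exact hτ.setVar hv _ _
    · have h₅ : cntReg j ≠ varReg (nv v) := by grind
      have h₆ : limReg j ≠ varReg (nv v) := by grind
      simp only [Function.update_of_ne h₅, Function.update_of_ne h₆]
      exact ⟨h₃ _ (by grind), h₃ _ (by grind)⟩
  | store a e f =>
    intro d σ s h
    obtain ⟨τ, h₁, h₂, h₃, h₄, h₅⟩ := e.compile_pair_spec f σ h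
    refine ⟨_, (h₁.seq (RunsIn.instr _ τ)).mono (by simp [stepBound, Instr.steps]), ?_,
      fun j _ => ⟨h₄ _ (by grind), h₄ _ (by grind)⟩⟩
    refine ⟨h₅.len, h₅.var, fun a' => ?_⟩
    simp only [Instr.run, h₂, h₃, run, Store.setArr]
    by_cases haa : a' = a
    · subst haa
      simp [h₅.arr]
    · simp [Function.update_of_ne, haa, ha.ne haa, h₅.arr]
  | seq c c' ih ih' =>
    intro d σ s h
    obtain ⟨τ, h₁, h₂, h₃⟩ := ih d σ s h
    obtain ⟨ρ, k₁, k₂, k₃⟩ := ih' d τ _ h₂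
    exact ⟨ρ, (h₁.seq k₁).mono (by simp [stepBound]), k₂, fun j hj =>
      ⟨(k₃ j hj).1.trans (h₃ j hj).1, (k₃ j hj).2.trans (h₃ j hj).2⟩⟩
  | ite e f c c' ih ih' =>
    intro d σ s h
    obtain ⟨τ, h₁, h₂, h₃, h₄, h₅⟩ := e.compile_pair_spec f σ h
    by_cases hlt : e.eval s < f.eval s
    · obtain ⟨ρ, k₁, k₂, k₃⟩ := ih d τ s h₅
      refine ⟨ρ, (h₁.seq (.iteTrue (by rwa [h₂, h₃]) k₁)).mono (by simp [stepBound]; omega),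
        by simpa [run, hlt] using k₂, fun j hj => ?_⟩
      rw [(k₃ j hj).1, (k₃ j hj).2]
      exact ⟨h₄ _ (by grind), h₄ _ (by grind)⟩
    · obtain ⟨ρ, k₁, k₂, k₃⟩ := ih' d τ s h₅
      refine ⟨ρ, (h₁.seq (.iteFalse (by rwa [h₂, h₃]) k₁)).mono (by simp [stepBound]; omega),
        by simpa [run, hlt] using k₂, fun j hj => ?_⟩
      rw [(k₃ j hj).1, (k₃ j hj).2]
      exact ⟨h₄ _ (by grind), h₄ _ (by grind)⟩
  | loop i e c ih =>
    intro d σ s h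
    obtain ⟨τ, h₁, h₂, h₃, h₄⟩ := e.compile_spec 0 σ h
    have hτ := h.of_tmp (fun r hr => h₃ r fun j _ => hr j) h₄
    set m := min (e.eval s) M with hm
    -- the state in which the limit and the counter have been set
    set τ' : State := { τ with
      reg := Function.update (Function.update τ.reg (limReg d) m) (cntReg d) 0 } with hτ'
    have run₁ : RunsIn (.seq (.seq (.seq (e.compile nv na 0) (move (limReg d) (tmpReg 0)))
        (.ite 0 (limReg d) (move (limReg d) 0) .skip)) (.instr (.const (cntReg d) 0))) σ
        (e.steps + 2 + 3 + 1) τ' := by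
      have r₁ := h₁.seq (RunsIn.move (d := limReg d) (a := tmpReg 0) (by grind) τ)
      rw [h₂] at r₁
      have r₂ : RunsIn (.ite 0 (limReg d) (move (limReg d) 0) .skip)
          { τ with reg := Function.update τ.reg (limReg d) (e.eval s) } (1 + 2)
          { τ with reg := Function.update τ.reg (limReg d) m } := by
        by_cases hlt : M < e.eval s
        · have := RunsIn.iteTrue (a := 0) (b := limReg d) (q := .skip)
            (σ := { τ with reg := Function.update τ.reg (limReg d) (e.eval s) })
            (by simpa [hτ.len] using hlt) (RunsIn.move (d := limReg d) (a := 0) (by grind) _)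
          simpa [hτ.len, hm, min_eq_right hlt.le] using this
        · have := RunsIn.iteFalse (a := 0) (b := limReg d) (p := move (limReg d) 0)
            (σ := { τ with reg := Function.update τ.reg (limReg d) (e.eval s) })
            (by simpa [hτ.len] using hlt) (RunsIn.skip _)
          rw [hm, min_eq_left (not_lt.1 hlt)]
          exact this.mono (by grind)
      exact ((r₁.seq r₂).seq (RunsIn.instr (.const (cntReg d) 0) _)).mono
        (by simp [Instr.steps])
    have rep₁ : Represents nv na M τ' s := by
      refine ⟨by simp [hτ', hτ.len], fun v => ?_, hτ.arr⟩
      have n₁ : varReg (nv v) ≠ cntReg d := by grind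
      have n₂ : varReg (nv v) ≠ limReg d := by grind
      simp only [hτ', Function.update_of_ne n₁, Function.update_of_ne n₂, hτ.var]
    have old₁ : ∀ j < d, τ'.reg (cntReg j) = σ.reg (cntReg j) ∧
        τ'.reg (limReg j) = σ.reg (limReg j) := by
      intro j hj
      have n₁ : cntReg j ≠ cntReg d := by grind
      have n₂ : cntReg j ≠ limReg d := by grind
      have n₃ : limReg j ≠ cntReg d := by grind
      have n₄ : limReg j ≠ limReg d := by grind
      simp only [hτ', Function.update_of_ne n₁, Function.update_of_ne n₂,
        Function.update_of_ne n₃, Function.update_of_ne n₄]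
      exact ⟨h₃ _ (by grind), h₃ _ (by grind)⟩
    -- the remaining `l` rounds
    have rounds : ∀ l k, k + l = m → ∀ ρ, Represents nv na M ρ (s.iterate i (c.run M) k) →
        ρ.reg (cntReg d) = k → ρ.reg (limReg d) = m →
        ∃ ρ', RunsIn (.while (cntReg d) (limReg d)
          (.seq (.seq (move (varReg (nv i)) (cntReg d)) (c.compile nv na (d + 1)))
            (.seq (.instr (.const (tmpReg 0) 1))
              (.instr (.add (cntReg d) (cntReg d) (tmpReg 0)))))) ρ
          (l * (c.stepBound.eval M + 6) + 1) ρ' ∧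
          Represents nv na M ρ' (s.iterate i (c.run M) m) ∧
          ∀ j < d, ρ'.reg (cntReg j) = ρ.reg (cntReg j) ∧
            ρ'.reg (limReg j) = ρ.reg (limReg j) := by
      intro l
      induction l with
      | zero =>
        intro k hk ρ hρ hcnt hlim
        obtain rfl : k = m := by grind
        exact ⟨ρ, (RunsIn.whileFalse (by grind)).mono (by grind), hρ, fun _ _ => ⟨rfl, rfl⟩⟩
      | succ l ihl =>
        intro k hk ρ hρ hcnt hlim
        have r₁ := RunsIn.move (d := varReg (nv i)) (a := cntReg d) (by grind) ρ
        rw [hcnt] at r₁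
        obtain ⟨ρ₂, r₂, rep₂, old₂⟩ := ih (d + 1) _ _ (hρ.setVar hv i k)
        have r₃ := (RunsIn.instr (.const (tmpReg 0) 1) ρ₂).seq
          (RunsIn.instr (.add (cntReg d) (cntReg d) (tmpReg 0)) _)
        set ρ₃ := Instr.run (.add (cntReg d) (cntReg d) (tmpReg 0))
          (Instr.run (.const (tmpReg 0) 1) ρ₂) with hρ₃
        have eq₃ : ∀ r, r ≠ cntReg d → r ≠ tmpReg 0 → ρ₃.reg r = ρ₂.reg r := by
          intro r hr hr'
          simp [hρ₃, Instr.run, Function.update_of_ne hr, Function.update_of_ne hr']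
        have old₂' : ∀ j < d + 1, ρ₂.reg (cntReg j) = ρ.reg (cntReg j) ∧
            ρ₂.reg (limReg j) = ρ.reg (limReg j) := by
          intro j hj
          have n₁ : cntReg j ≠ varReg (nv i) := by grind
          have n₂ : limReg j ≠ varReg (nv i) := by grind
          simpa only [Function.update_of_ne n₁, Function.update_of_ne n₂] using old₂ j hj
        have rep₃ : Represents nv na M ρ₃ (s.iterate i (c.run M) (k + 1)) :=
          ⟨(eq₃ _ (by grind) (by grind)).trans rep₂.len,
            fun v => (eq₃ _ (by grind) (by grind)).trans (rep₂.var v), rep₂.arr⟩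
        have cnt₃ : ρ₃.reg (cntReg d) = k + 1 := by
          have n₁ : cntReg d ≠ tmpReg 0 := by grind
          simp [hρ₃, Instr.run, Function.update_of_ne n₁, (old₂' d (by grind)).1, hcnt]
        have lim₃ : ρ₃.reg (limReg d) = m := by
          rw [eq₃ _ (by grind) (by grind), (old₂' d (by grind)).2, hlim]
        obtain ⟨ρ₄, r₄, rep₄, old₄⟩ := ihl (k + 1) (by grind) ρ₃ rep₃ cnt₃ lim₃
        refine ⟨ρ₄, (RunsIn.whileTrue (by grind) ((r₁.seq r₂).seq r₃) r₄).mono ?_, rep₄,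
          fun j hj => ?_⟩
        · simp only [Instr.steps, Nat.size_one]
          rw [add_mul]
          omega
        · rw [(old₄ j hj).1, (old₄ j hj).2, eq₃ _ (by grind) (by grind),
            eq₃ _ (by grind) (by grind)]
          exact old₂' j (by grind)
    obtain ⟨ρ, r, rep, old⟩ := rounds m 0 (by grind) τ' rep₁ (by simp [hτ']) (by simp [hτ'])
    refine ⟨ρ, (run₁.seq r).mono ?_, rep, fun j hj => ?_⟩
    · simp only [stepBound, Polynomial.eval_add, Polynomial.eval_mul, Polynomial.eval_C,
        Polynomial.eval_X]
      have : m * (Polynomial.eval M c.stepBound + 6) ≤ M * (Polynomial.eval M c.stepBound + 6) :=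
        Nat.mul_le_mul_right _ (min_le_right _ _)
      omega
    · rw [(old j hj).1, (old j hj).2]
      exact old₁ j hj

/-- The store at the start: the array `input` holds the word `w`, everything else is `0`. -/
def Store.initial (input : A) (w : List ℕ) : Store V A where
  var := fun _ => 0
  arr := fun a j => if a = input then w.getD j 0 else 0

theorem size_getD_le_inputSize (w : List ℕ) (j : ℕ) : Nat.size (w.getD j 0) ≤ inputSize w := by
  by_cases hj : j < w.length
  · rw [List.getD_eq_getElem _ _ hj]
    have : Nat.size w[j] + 1 ≤ inputSize w :=
      List.single_le_sum (by simp) _ (List.mem_map.2 ⟨w[j], List.getElem_mem hj, rfl⟩)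
    omega
  · rw [List.getD_eq_default _ _ (not_lt.1 hj)]
    simp

theorem length_le_inputSize (w : List ℕ) : w.length ≤ inputSize w := by
  induction w with
  | nil => simp
  | cons a w ih =>
    simp only [inputSize, List.map_cons, List.sum_cons, List.length_cons] at ih ⊢
    omega

theorem init_bounded (w : List ℕ) : (init w).Bounded (inputSize w) := by
  have hlen : Nat.size w.length ≤ inputSize w :=
    (Nat.size_le.2 w.length.lt_two_pow_self).trans (length_le_inputSize w)
  refine ⟨fun i => ?_, fun k j => ?_⟩
  · simp only [init]
    split_ifs
    · exact hlen
    · simp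
  · simp only [init]
    split_ifs
    · exact size_getD_le_inputSize w j
    · simp

theorem eval_mono_nat (P : Polynomial ℕ) {a b : ℕ} (h : a ≤ b) : P.eval a ≤ P.eval b := by
  simp only [Polynomial.eval_eq_sum]
  exact Finset.sum_le_sum fun i _ => by dsimp only; gcongr

/-- A command that computes the right answer witnesses decidability in polynomial time. -/
theorem decidableInPolyTime_of_cmd (hv : nv.Injective) (ha : na.Injective) {input : A}
    (hin : na input = 0) (out : V) (c : Cmd V A) {ι : Type*} (enc : ι → List ℕ) (yes : ι → Prop)
    (hyes : ∀ i, yes i →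
      (c.run (enc i).length (Store.initial input (enc i))).var out = 1)
    (hno : ∀ i, ¬ yes i →
      (c.run (enc i).length (Store.initial input (enc i))).var out = 0) :
    DecidableInPolyTime enc yes := by
  refine ⟨.seq (c.compile nv na 0) (move 0 (varReg (nv out))),
    (c.stepBound + 2) * (1 + 2 * (.X + (c.stepBound + 2))), fun i => ?_⟩
  set w := enc i
  have rep : Represents nv na w.length (init w) (Store.initial input w) := by
    refine ⟨by simp [init], fun v => by simp [init, Store.initial], fun a => ?_⟩
    funext j
    by_cases h : a = input
    · subst h
      simp [init, Store.initial, hin]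
    · simp [init, Store.initial, h, ← hin, ha.ne h]
  obtain ⟨τ, h₁, h₂, -⟩ := c.compile_spec hv ha 0 _ _ rep
  obtain ⟨t, ht, H⟩ := h₁.seq (RunsIn.move (d := 0) (a := varReg (nv out)) (by grind) τ)
  refine ⟨t, _, ht, ?_, fun h => ?_, fun h => ?_⟩
  · refine (H _ (init_bounded w)).2.trans ?_
    simp only [Polynomial.eval_mul, Polynomial.eval_add, Polynomial.eval_X, Polynomial.eval_one,
      Polynomial.eval_ofNat]
    have := eval_mono_nat c.stepBound (length_le_inputSize w)
    gcongr
  · simpa [h₂.var] using hyes i h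
  · simpa [h₂.var] using hno i h

end Compile

end RAM

/-! ### Cheapest models of a DNNF circuit -/

/-- The cost of the truth assignment `α`, if setting the issue `x` to `b` costs `c x b`. -/
def assignmentCost (n : ℕ) (c : ℕ → Bool → ℕ) (α : ℕ → Bool) : ℕ :=
  ∑ x ∈ Finset.range n, c x (α x)

/-- The cost of a literal relative to that of the complementary literal.  For every issue one of
the two literals has relative cost `0`, so that variables on which nothing depends may be
ignored. -/
def relCost (c : ℕ → Bool → ℕ) (x : ℕ) (b : Bool) : ℕ := c x b - c x !b

/-- The sum of the costs of the cheaper literals. -/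
def baseCost (n : ℕ) (c : ℕ → Bool → ℕ) : ℕ :=
  ∑ x ∈ Finset.range n, (c x true - (c x true - c x false))

theorem assignmentCost_eq (n : ℕ) (c : ℕ → Bool → ℕ) (α : ℕ → Bool) :
    assignmentCost n c α = baseCost n c + assignmentCost n (relCost c) α := by
  simp only [assignmentCost, baseCost, ← Finset.sum_add_distrib, relCost]
  refine Finset.sum_congr rfl fun x _ => ?_
  cases α x <;> simp
  omega

/-- The cheaper one of the two truth values of a variable. -/
def cheapValue (c : ℕ → Bool → ℕ) (x : ℕ) : Bool := decide (c x true < c x false)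

theorem relCost_cheapValue (c : ℕ → Bool → ℕ) (x : ℕ) : relCost c x (cheapValue c x) = 0 := by
  by_cases h : c x true < c x false <;> simp [relCost, cheapValue, h] <;> omega

namespace Circuit

variable {C : Circuit}

theorem varsAt_subset_of_arc {i j : Fin C.numNodes} (h : C.Arc i j) : C.varsAt j ⊆ C.varsAt i := by
  rintro x ⟨k, b, hk, hl⟩
  exact ⟨k, b, .head h hk, hl⟩

theorem arc_of_and {i j : Fin C.numNodes} {cs : List (Fin C.numNodes)} (h : C.label i = .and cs)
    (hj : j ∈ cs) : C.Arc i j := by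
  simpa [Arc, h, NodeLabel.children] using hj

theorem arc_of_or {i j : Fin C.numNodes} {cs : List (Fin C.numNodes)} (h : C.label i = .or cs)
    (hj : j ∈ cs) : C.Arc i j := by
  simpa [Arc, h, NodeLabel.children] using hj

/-- The value of a node depends only on the variables of its subcircuit. -/
theorem Holds.congr {α β : ℕ → Bool} {i : Fin C.numNodes} (hi : C.Holds α i) :
    (∀ x ∈ C.varsAt i, α x = β x) → C.Holds β i := by
  induction hi with
  | top h => exact fun _ => .top h
  | @lit i x b h h' => exact fun H => .lit h ((H x ⟨i, b, .refl, h⟩).symm.trans h')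
  | and h _ ih =>
    exact fun H => .and h fun j hj =>
      ih j hj fun x hx => H x (varsAt_subset_of_arc (arc_of_and h hj) hx)
  | or j h hj _ ih =>
    exact fun H => .or j h hj (ih fun x hx => H x (varsAt_subset_of_arc (arc_of_or h hj) hx))

/-- `v` is the least relative cost of a truth assignment under which the node `i` is true, where
`K` plays the role of infinity. -/
structure IsLeastCost (C : Circuit) (n : ℕ) (c : ℕ → Bool → ℕ) (K : ℕ) (i : Fin C.numNodes)
    (v : ℕ) : Prop where
  le : ∀ α, C.Holds α i → v ≤ assignmentCost n (relCost c) α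
  attained : v < K → ∃ α, C.Holds α i ∧ assignmentCost n (relCost c) α = v

/-- The value of a node, computed from the values `V` of the children. -/
def nodeCost {N : ℕ} (n : ℕ) (c : ℕ → Bool → ℕ) (K : ℕ) (V : Fin N → ℕ) :
    NodeLabel (Fin N) → ℕ
  | .top => 0
  | .bot => K
  | .lit x b => if x < n then relCost c x b else 0
  | .and cs => (cs.map V).sum
  | .or cs => (cs.map V).foldl min K

section

variable {n : ℕ} {c : ℕ → Bool → ℕ} {K : ℕ}

open scoped Classical in
/-- The part of the relative cost that the variables of a subcircuit account for.  It is the whole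
cost of an assignment that is cheap on all other variables. -/
theorem assignmentCost_modify (S : Set ℕ) (α : ℕ → Bool) :
    assignmentCost n (relCost c) (fun x => if x ∈ S then α x else cheapValue c x) =
      ∑ x ∈ Finset.range n with x ∈ S, relCost c x (α x) := by
  rw [assignmentCost, Finset.sum_filter]
  refine Finset.sum_congr rfl fun x _ => ?_
  by_cases h : x ∈ S <;> simp [h, relCost_cheapValue]

open scoped Classical in
theorem IsLeastCost.le_sum_varsAt {i : Fin C.numNodes} {v : ℕ} (h : C.IsLeastCost n c K i v)
    {α : ℕ → Bool} (hα : C.Holds α i) :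
    v ≤ ∑ x ∈ Finset.range n with x ∈ C.varsAt i, relCost c x (α x) := by
  rw [← assignmentCost_modify]
  exact h.le _ (hα.congr fun x hx => by simp [hx])

theorem le_foldl_min {l : List ℕ} {K v : ℕ} :
    v ≤ l.foldl min K ↔ v ≤ K ∧ ∀ a ∈ l, v ≤ a := by
  induction l generalizing K with
  | nil => simp
  | cons a l ih => simp [ih, and_assoc]

theorem foldl_min_mem (l : List ℕ) (K : ℕ) : l.foldl min K = K ∨ l.foldl min K ∈ l := by
  induction l generalizing K with
  | nil => simp
  | cons a l ih =>
    rcases ih (min K a) with h | h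
    · rw [List.foldl_cons, h]
      rcases min_choice K a with h' | h' <;> simp [h']
    · simp [h]

open scoped Classical in
/-- The variables of the children of a conjunction are disjoint, so that costs add up and cheapest
assignments can be glued together. -/
theorem isLeastCost_and (hC : C.IsDNNF) {i : Fin C.numNodes} {cs : List (Fin C.numNodes)}
    (hi : C.label i = .and cs) {V : Fin C.numNodes → ℕ}
    (hV : ∀ j ∈ cs, C.IsLeastCost n c K j (V j)) :
    C.IsLeastCost n c K i (cs.map V).sum := by
  have hnd : cs.Nodup := by simpa [hi, NodeLabel.children] using hC.children_nodup i
  rw [← List.sum_toFinset V hnd]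
  have hdisj : (cs.toFinset : Set (Fin C.numNodes)).PairwiseDisjoint
      fun j => Finset.range n |>.filter (· ∈ C.varsAt j) := by
    intro j hj k hk hjk
    rw [Function.onFun, Finset.disjoint_filter]
    exact fun x _ hx => Set.disjoint_left.1
      (hC.decomposable i cs hi j (by simpa using hj) k (by simpa using hk) hjk) hx
  have hle : ∀ α, C.Holds α i → ∑ j ∈ cs.toFinset, V j ≤ assignmentCost n (relCost c) α := by
    intro α hα
    have hα' : ∀ j ∈ cs, C.Holds α j := by simpa [hi] using (C.holds_iff α i).1 hα
    calc ∑ j ∈ cs.toFinset, V j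
        ≤ ∑ j ∈ cs.toFinset, ∑ x ∈ Finset.range n with x ∈ C.varsAt j, relCost c x (α x) :=
          Finset.sum_le_sum fun j hj =>
            (hV j (by simpa using hj)).le_sum_varsAt (hα' j (by simpa using hj))
      _ = ∑ x ∈ cs.toFinset.biUnion fun j => Finset.range n |>.filter (· ∈ C.varsAt j),
            relCost c x (α x) := (Finset.sum_biUnion hdisj).symm
      _ ≤ _ := Finset.sum_le_sum_of_subset (Finset.biUnion_subset.2 fun j _ =>
          Finset.filter_subset _ _)
  refine ⟨hle, fun hK => ?_⟩
  have hVK : ∀ j ∈ cs, V j < K := fun j hj =>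
    (Finset.single_le_sum (fun _ _ => Nat.zero_le _) (by simpa using hj)).trans_lt hK
  choose! A hA hA' using fun j hj => (hV j hj).attained (hVK j hj)
  -- glue the cheapest assignments of the children
  set β : ℕ → Bool := fun x =>
    if h : ∃ j ∈ cs, x ∈ C.varsAt j then A h.choose x else cheapValue c x with hβ
  have hβA : ∀ j ∈ cs, ∀ x ∈ C.varsAt j, A j x = β x := by
    intro j hj x hx
    have h : ∃ j ∈ cs, x ∈ C.varsAt j := ⟨j, hj, hx⟩
    have : h.choose = j := by
      by_contra hne
      exact Set.disjoint_left.1 (hC.decomposable i cs hi _ h.choose_spec.1 j hj hne)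
        h.choose_spec.2 hx
    simp only [hβ, dif_pos h, this]
  have hβi : C.Holds β i := .and hi fun j hj => (hA j hj).congr (hβA j hj)
  refine ⟨β, hβi, le_antisymm ?_ (hle β hβi)⟩
  calc assignmentCost n (relCost c) β
      = ∑ x ∈ cs.toFinset.biUnion fun j => Finset.range n |>.filter (· ∈ C.varsAt j),
          relCost c x (β x) := by
        refine (Finset.sum_subset (Finset.biUnion_subset.2 fun j _ =>
          Finset.filter_subset _ _) fun x hx hx' => ?_).symm
        have h : ¬ ∃ j ∈ cs, x ∈ C.varsAt j := by
          rintro ⟨j, hj, hxj⟩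
          exact hx' (Finset.mem_biUnion.2
            ⟨j, by simpa using hj, Finset.mem_filter.2 ⟨hx, hxj⟩⟩)
        simp only [hβ, dif_neg h, relCost_cheapValue]
    _ = ∑ j ∈ cs.toFinset, ∑ x ∈ Finset.range n with x ∈ C.varsAt j, relCost c x (β x) :=
        Finset.sum_biUnion hdisj
    _ ≤ ∑ j ∈ cs.toFinset, V j := by
        refine Finset.sum_le_sum fun j hj => ?_
        rw [List.mem_toFinset] at hj
        rw [← hA' j hj, assignmentCost]
        rw [Finset.sum_congr rfl fun x hx => by
          rw [← hβA j hj x (Finset.mem_filter.1 hx).2]]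
        exact Finset.sum_le_sum_of_subset (Finset.filter_subset _ _)

theorem isLeastCost_nodeCost (hC : C.IsDNNF) {i : Fin C.numNodes} {V : Fin C.numNodes → ℕ}
    (hV : ∀ j, C.Arc i j → C.IsLeastCost n c K j (V j)) :
    C.IsLeastCost n c K i (nodeCost n c K V (C.label i)) := by
  cases hi : C.label i with
  | top =>
    refine ⟨fun _ _ => Nat.zero_le _, fun _ => ⟨cheapValue c, .top hi, ?_⟩⟩
    simp [assignmentCost, relCost_cheapValue, nodeCost]
  | bot =>
    refine ⟨fun α hα => ?_, fun h => absurd h (lt_irrefl _)⟩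
    simp [C.holds_iff α i, hi] at hα
  | lit x b =>
    simp only [nodeCost]
    constructor
    · intro α hα
      obtain rfl : α x = b := by simpa [hi] using (C.holds_iff α i).1 hα
      split_ifs with hx
      · exact Finset.single_le_sum (f := fun x => relCost c x (α x)) (fun _ _ => Nat.zero_le _)
          (Finset.mem_range.2 hx)
      · exact Nat.zero_le _
    · intro _
      refine ⟨Function.update (cheapValue c) x b, .lit hi (by simp), ?_⟩
      have h : ∀ y, relCost c y (Function.update (cheapValue c) x b y) =
          if y = x then relCost c x b else 0 := by
        intro y
        by_cases hy : y = x
        · subst hy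
          simp
        · simp [hy, relCost_cheapValue]
      simp [assignmentCost, h]
  | and cs => exact isLeastCost_and hC hi fun j hj => hV j (arc_of_and hi hj)
  | or cs =>
    simp only [nodeCost]
    constructor
    · intro α hα
      obtain ⟨j, hj, hαj⟩ : ∃ j ∈ cs, C.Holds α j := by
        simpa [hi] using (C.holds_iff α i).1 hα
      exact ((le_foldl_min.1 le_rfl).2 _ (List.mem_map_of_mem hj)).trans
        ((hV j (arc_of_or hi hj)).le α hαj)
    · intro hK
      rcases foldl_min_mem (cs.map V) K with h | h
      · omega
      · obtain ⟨j, hj, hjV⟩ := List.mem_map.1 h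
        rw [← hjV] at hK ⊢
        obtain ⟨α, hα, hα'⟩ := (hV j (arc_of_or hi hj)).attained hK
        exact ⟨α, .or j hi hj hα, hα'⟩

/-- The cost of the cheapest model from the value of the root. -/
theorem IsLeastCost.isLeast {v : ℕ} (h : C.IsLeastCost n c K C.root v) (hsat : ∃ α, C.Sat α)
    (hK : ∀ α, assignmentCost n (relCost c) α < K) :
    IsLeast {m | ∃ α, C.Sat α ∧ assignmentCost n c α = m} (baseCost n c + v) := by
  obtain ⟨α, hα⟩ := hsat
  obtain ⟨β, hβ, hβ'⟩ := h.attained ((h.le α hα).trans_lt (hK α))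
  refine ⟨⟨β, hβ, by rw [assignmentCost_eq, hβ']⟩, ?_⟩
  rintro _ ⟨γ, hγ, rfl⟩
  rw [assignmentCost_eq]
  exact Nat.add_le_add_left (h.le γ hγ) _

end

/-- In an acyclic circuit, the number of descendants decreases along arcs. -/
theorem exists_rank (h : ∀ i, ¬ Relation.TransGen C.Arc i i) :
    ∃ rank : Fin C.numNodes → ℕ, (∀ i, rank i < C.numNodes) ∧
      ∀ i j, C.Arc i j → rank j < rank i := by
  refine ⟨fun i => {j | Relation.TransGen C.Arc i j}.ncard, fun i => ?_, fun i j hij => ?_⟩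
  · have := Set.ncard_lt_ncard (s := {j | Relation.TransGen C.Arc i j}) (t := Set.univ)
      (Set.ssubset_univ_iff.2 fun hu => h i (Set.eq_univ_iff_forall.1 hu i))
    simpa [Set.ncard_univ] using this
  · refine Set.ncard_lt_ncard ((Set.ssubset_iff_of_subset fun k hk => ?_).2 ⟨j, .single hij, h j⟩)
    exact .head hij hk

end Circuit

/-! ### Reversal scoring as an optimization problem over models -/

section Aggregation

variable {n : ℕ} {Γ : Circuit}

theorem isLeast_rationalBallots {c : ℕ → Bool → ℕ} {m : ℕ}
    (h : IsLeast {m | ∃ α, Γ.Sat α ∧ assignmentCost n c α = m} m) :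
    IsLeast {m | ∃ r ∈ rationalBallots n Γ, ∑ x : Fin n, c x (r x) = m} m := by
  obtain ⟨⟨α, hα, hm⟩, hle⟩ := h
  refine ⟨⟨fun x => α x, ⟨α, fun _ => rfl, hα⟩, ?_⟩, ?_⟩
  · rw [← hm, assignmentCost, Finset.sum_range fun x => c x (α x)]
  · rintro _ ⟨r, ⟨β, hβr, hβ⟩, rfl⟩
    refine hle ⟨β, hβ, ?_⟩
    rw [assignmentCost, Finset.sum_range fun x => c x (β x)]
    simp only [hβr]

/-- The costs of the literals that measure the Hamming distance to `r`, except that there is a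
penalty that exceeds all distances for agreeing with `r` on the issue `x`. -/
def reversalCost (r : Ballot n) (x y : Fin n) (b : Bool) : ℕ :=
  if y = x ∧ b = r x then n + 1 else if b = r y then 0 else 1

theorem sum_reversalCost_of_ne {r r' : Ballot n} {x : Fin n} (h : r' x ≠ r x) :
    ∑ y, reversalCost r x y (r' y) = hammingDist r r' := by
  rw [hammingDist, Finset.card_filter]
  refine Finset.sum_congr rfl fun y _ => ?_
  have h₁ : ¬ (y = x ∧ r' y = r x) := by
    rintro ⟨rfl, h'⟩
    exact h h'
  simp only [reversalCost, h₁, if_false]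
  by_cases h₂ : r' y = r y
  · simp [h₂]
  · simp [h₂, Ne.symm h₂]

theorem lt_sum_reversalCost_of_eq {r r' : Ballot n} {x : Fin n} (h : r' x = r x) :
    n < ∑ y, reversalCost r x y (r' y) := by
  have : reversalCost r x x (r' x) ≤ ∑ y, reversalCost r x y (r' y) :=
    Finset.single_le_sum (f := fun y => reversalCost r x y (r' y)) (fun _ _ => Nat.zero_le _)
      (Finset.mem_univ x)
  simp only [reversalCost, h, and_self, if_true] at this
  simp only [reversalCost]
  omega

theorem reversalScore_of_val_eq {R : Set (Ballot n)} {r : Ballot n} {x : Fin n} {m : ℕ}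
    (h : IsLeast {m | ∃ r' ∈ R, ∑ y, reversalCost r x y (r' y) = m} m) :
    reversalScore R r (x, r x) = if m < n + 1 then m else 0 := by
  obtain ⟨⟨r', hr', hm⟩, hle⟩ := h
  have hval : ∀ r'' : Ballot n, r''.val (x, r x) = false ↔ r'' x ≠ r x := by
    intro r''
    simp [Ballot.val]
  simp only [reversalScore, hval]
  split_ifs with hlt
  · have hne : r' x ≠ r x := fun h => by
      have := lt_sum_reversalCost_of_eq h
      omega
    refine (IsLeast.csInf_eq ⟨⟨r', hr', hne, ?_⟩, ?_⟩)
    · rw [← sum_reversalCost_of_ne hne, hm]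
    · rintro _ ⟨r'', hr'', hne', rfl⟩
      rw [← sum_reversalCost_of_ne hne']
      exact hle ⟨r'', hr'', rfl⟩
  · have hempty : {d | ∃ r' ∈ R, r' x ≠ r x ∧ hammingDist r r' = d} = ∅ := by
      refine Set.eq_empty_of_forall_notMem ?_
      rintro _ ⟨r'', hr'', hne', rfl⟩
      have h₁ := hle ⟨r'', hr'', sum_reversalCost_of_ne hne'⟩
      have h₂ : hammingDist r r'' ≤ n := by
        simpa using hammingDist_le_card_fintype (x := r) (y := r'')
      omega
    rw [hempty, Nat.sInf_empty]

/-- A literal that is false in a rational ballot has score `0` with respect to that ballot. -/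
theorem reversalScore_of_val_ne {R : Set (Ballot n)} {r : Ballot n} (hr : r ∈ R) {x : Fin n}
    {b : Bool} (hb : b ≠ r x) : reversalScore R r (x, b) = 0 :=
  Nat.sInf_eq_zero.2 (Or.inl ⟨r, hr, by simpa [Ballot.val] using hb.symm, hammingDist_self r⟩)

/-- The total score that a literal gets from the ballots of a profile. -/
noncomputable def literalWeight (R : Set (Ballot n)) (prof : List (Ballot n)) (x : Fin n)
    (b : Bool) : ℕ :=
  (prof.map fun r => reversalScore R r (x, b)).sum

theorem totalScore_eq (R : Set (Ballot n)) (prof : List (Ballot n)) (r : Ballot n) :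
    totalScore (reversalScore R) prof r = ∑ x, literalWeight R prof x (r x) := by
  have h : ∀ r', ∑ l : IssueLit n with r.val l = true, reversalScore R r' l =
      ∑ x, reversalScore R r' (x, r x) := by
    intro r'
    rw [Finset.sum_filter, Fintype.sum_prod_type]
    refine Finset.sum_congr rfl fun x _ => ?_
    rcases hx : r x <;> simp [Ballot.val, hx]
  simp only [totalScore, h, literalWeight]
  induction prof with
  | nil => simp
  | cons r' prof ih => simp [ih, Finset.sum_add_distrib]

/-- A rational ballot has maximal total score if and only if the total weight of the literals that
it makes false is minimal.  If disagreement with the partial ballot `s` is charged in addition,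
then the minimum stays the same precisely if some ballot of maximal score agrees with `s`. -/
theorem exists_agrees_iff {R : Set (Ballot n)} {prof : List (Ballot n)} {s : PartialBallot n}
    {m m' : ℕ}
    (h : IsLeast {m | ∃ r ∈ R, ∑ x, literalWeight R prof x (!r x) = m} m)
    (h' : IsLeast {m | ∃ r ∈ R, ∑ x, (literalWeight R prof x (!r x) +
      if s x = some (!r x) then 1 else 0) = m} m') :
    (∃ r ∈ reversalScoring R prof, s.Agrees r) ↔ ¬ m < m' := by
  have hsum : ∀ r : Ballot n, totalScore (reversalScore R) prof r +
      ∑ x, literalWeight R prof x (!r x) =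
      ∑ x, (literalWeight R prof x true + literalWeight R prof x false) := by
    intro r
    rw [totalScore_eq, ← Finset.sum_add_distrib]
    refine Finset.sum_congr rfl fun x _ => ?_
    cases r x <;> simp [add_comm]
  have hagree : ∀ r : Ballot n, s.Agrees r ↔
      ∑ x, (if s x = some (!r x) then 1 else 0) = 0 := by
    intro r
    simp only [PartialBallot.Agrees, Finset.sum_eq_zero_iff, Finset.mem_univ, true_implies]
    refine forall_congr' fun x => ?_
    rcases hs : s x with _ | b
    · simp
    · cases b <;> cases r x <;> simp
  constructor
  · rintro ⟨r, ⟨hr, hmax⟩, hs⟩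
    obtain ⟨⟨r₀, hr₀, hm⟩, -⟩ := h
    have h₁ := h'.2 ⟨r, hr, rfl⟩
    rw [Finset.sum_add_distrib, (hagree r).1 hs] at h₁
    have h₂ := hmax r₀ hr₀
    have h₃ := hsum r
    have h₄ := hsum r₀
    omega
  · intro hmm
    obtain ⟨⟨r, hr, hm'⟩, -⟩ := h'
    rw [Finset.sum_add_distrib] at hm'
    have h₁ := h.2 ⟨r, hr, rfl⟩
    refine ⟨r, ⟨hr, fun r' hr' => ?_⟩, (hagree r).2 (by omega)⟩
    have h₂ := h.2 ⟨r', hr', rfl⟩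
    have h₃ := hsum r
    have h₄ := hsum r'
    omega

end Aggregation

/-! ### Reading words -/

/-- The letter of the word `w` at position `j`; it is `0` beyond the end of the word. -/
def letter (w : List ℕ) (j : ℕ) : ℕ := w.getD j 0

/-- The word `u` stands in the word `w` at position `q`. -/
def StandsAt (w : List ℕ) (q : ℕ) (u : List ℕ) : Prop := u <+: w.drop q

namespace StandsAt

variable {w u v : List ℕ} {q a : ℕ}

theorem self (w : List ℕ) : StandsAt w 0 w := List.prefix_rfl

theorem append (h : StandsAt w q (u ++ v)) : StandsAt w q u ∧ StandsAt w (q + u.length) v := by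
  refine ⟨(List.prefix_append u v).trans h, ?_⟩
  obtain ⟨t, ht⟩ := h
  refine ⟨t, ?_⟩
  rw [← List.drop_drop, ← ht, List.append_assoc, List.drop_left]

theorem cons (h : StandsAt w q (a :: u)) : letter w q = a ∧ StandsAt w (q + 1) u := by
  refine ⟨?_, (append (u := [a]) h).2⟩
  obtain ⟨t, ht⟩ := h
  have : (w.drop q)[0]? = some a := by simp [← ht]
  rw [List.getElem?_drop, Nat.add_zero] at this
  simp [letter, this]

theorem length_le (h : StandsAt w q u) : u.length ≤ w.length := by
  have := List.IsPrefix.length_le h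
  rw [List.length_drop] at this
  omega

theorem letter_eq (h : StandsAt w q u) {k : ℕ} (hk : k < u.length) : letter w (q + k) = u[k] := by
  obtain ⟨t, ht⟩ := h
  have : (w.drop q)[k]? = some u[k] := by
    rw [← ht, List.getElem?_append_left hk, List.getElem?_eq_getElem hk]
  rw [List.getElem?_drop] at this
  simp [letter, this]

theorem flatMap {ι : Type*} {l : List ι} {f : ι → List ℕ} (h : StandsAt w q (l.flatMap f)) {k : ℕ}
    (hk : k < l.length) : StandsAt w (q + ((l.take k).flatMap f).length) (f l[k]) := by
  have : l.flatMap f = (l.take k).flatMap f ++ (f l[k] ++ (l.drop (k + 1)).flatMap f) := by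
    rw [← List.flatMap_cons, ← List.flatMap_append, List.getElem_cons_drop, List.take_append_drop]
  rw [this] at h
  exact h.append.2.append.1

end StandsAt

/-! ### Reasoning about commands -/

namespace RAM

section Reasoning

variable {V A : Type}

instance : Add (Expr V A) := ⟨Expr.add⟩

instance : Sub (Expr V A) := ⟨Expr.sub⟩

/-- A sequence of commands. -/
def Cmd.block : List (Cmd V A) → Cmd V A
  | [] => .skip
  | c :: cs => .seq c (block cs)

@[simp] theorem Expr.eval_lit (s : Store V A) (c : ℕ) : (Expr.lit c).eval s = c := rfl

@[simp] theorem Expr.eval_var (s : Store V A) (v : V) : (Expr.var v).eval s = s.var v := rfl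

@[simp] theorem Expr.eval_get (s : Store V A) (a : A) (e : Expr V A) :
    (Expr.get a e).eval s = s.arr a (e.eval s) := rfl

@[simp] theorem Expr.eval_add (s : Store V A) (e f : Expr V A) :
    (e + f).eval s = e.eval s + f.eval s := rfl

@[simp] theorem Expr.eval_sub (s : Store V A) (e f : Expr V A) :
    (e - f).eval s = e.eval s - f.eval s := rfl

/-- The variables to which a command may assign. -/
def Cmd.vars : Cmd V A → List V
  | .skip => []
  | .assign v _ => [v]
  | .store _ _ _ => []
  | .seq c d => c.vars ++ d.vars
  | .ite _ _ c d => c.vars ++ d.vars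
  | .loop i _ c => i :: c.vars

/-- The arrays to which a command may write. -/
def Cmd.arrs : Cmd V A → List A
  | .skip => []
  | .assign _ _ => []
  | .store a _ _ => [a]
  | .seq c d => c.arrs ++ d.arrs
  | .ite _ _ c d => c.arrs ++ d.arrs
  | .loop _ _ c => c.arrs

/-- The stores `s` and `s'` differ at most in what the command `c` may change. -/
structure Cmd.Frame (c : Cmd V A) (s s' : Store V A) : Prop where
  var : ∀ v, v ∉ c.vars → s'.var v = s.var v
  arr : ∀ a, a ∉ c.arrs → s'.arr a = s.arr a

@[simp] theorem Store.setVar_arr [DecidableEq V] (s : Store V A) (v : V) (k : ℕ) :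
    (s.setVar v k).arr = s.arr := rfl

@[simp] theorem Store.setArr_var [DecidableEq A] (s : Store V A) (a : A) (j k : ℕ) :
    (s.setArr a j k).var = s.var := rfl

@[simp] theorem Store.setVar_var [DecidableEq V] (s : Store V A) (v v' : V) (k : ℕ) :
    (s.setVar v k).var v' = if v' = v then k else s.var v' := by
  simp [setVar, Function.update_apply]

@[simp] theorem Store.setArr_arr [DecidableEq A] (s : Store V A) (a a' : A) (j k : ℕ) :
    (s.setArr a j k).arr a' = if a' = a then Function.update (s.arr a) j k else s.arr a' := by
  simp only [setArr, Function.update_apply]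

theorem Cmd.Frame.setVar_left [DecidableEq V] {c : Cmd V A} {s s' : Store V A} {i : V} {k : ℕ}
    (h : c.Frame s s') (e : Expr V A) : (Cmd.loop i e c).Frame s (s'.setVar i k) := by
  refine ⟨fun v hv => ?_, h.arr⟩
  simp only [vars, List.mem_cons, not_or] at hv
  simp [hv.1, h.var v hv.2]

variable [DecidableEq V] [DecidableEq A]

section

variable (M : ℕ) (s : Store V A)

@[simp] theorem Cmd.run_skip : (Cmd.skip : Cmd V A).run M s = s := rfl

@[simp] theorem Cmd.run_assign (v : V) (e : Expr V A) :
    (Cmd.assign v e).run M s = s.setVar v (e.eval s) := rfl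

@[simp] theorem Cmd.run_store (a : A) (e f : Expr V A) :
    (Cmd.store a e f).run M s = s.setArr a (e.eval s) (f.eval s) := rfl

@[simp] theorem Cmd.run_ite (e f : Expr V A) (c d : Cmd V A) :
    (Cmd.ite e f c d).run M s = if e.eval s < f.eval s then c.run M s else d.run M s := rfl

@[simp] theorem Cmd.run_block_nil : (Cmd.block ([] : List (Cmd V A))).run M s = s := rfl

@[simp] theorem Cmd.run_block_cons (c : Cmd V A) (cs : List (Cmd V A)) :
    (Cmd.block (c :: cs)).run M s = (Cmd.block cs).run M (c.run M s) := rfl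

end

theorem Cmd.frame_iterate {c : Cmd V A} {M : ℕ} (hc : ∀ s, c.Frame s (c.run M s)) (i : V)
    (e : Expr V A) (s : Store V A) (k : ℕ) :
    (Cmd.loop i e c).Frame s (s.iterate i (c.run M) k) := by
  induction k with
  | zero => exact ⟨fun _ _ => rfl, fun _ _ => rfl⟩
  | succ k ih =>
    constructor
    · intro v hv
      have hv' := hv
      simp only [vars, List.mem_cons, not_or] at hv'
      simp only [Store.iterate]
      rw [(hc _).var v hv'.2, Store.setVar_var, if_neg hv'.1, ih.var v hv]
    · intro a h
      simp only [Store.iterate]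
      rw [(hc _).arr a h, Store.setVar_arr, ih.arr a h]

theorem Cmd.frame_run (M : ℕ) (c : Cmd V A) : ∀ s, c.Frame s (c.run M s) := by
  induction c with
  | skip => exact fun s => ⟨fun _ _ => rfl, fun _ _ => rfl⟩
  | assign v e =>
    refine fun s => ⟨fun v' hv => ?_, fun _ _ => rfl⟩
    simp only [vars, List.mem_singleton] at hv
    simp [hv]
  | store a e f =>
    refine fun s => ⟨fun _ _ => rfl, fun a' h => ?_⟩
    simp only [arrs, List.mem_singleton] at h
    simp [h]
  | seq c d ihc ihd =>
    intro s
    constructor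
    · intro v hv
      simp only [vars, List.mem_append, not_or] at hv
      exact ((ihd _).var v hv.2).trans ((ihc s).var v hv.1)
    · intro a h
      simp only [arrs, List.mem_append, not_or] at h
      exact ((ihd _).arr a h.2).trans ((ihc s).arr a h.1)
  | ite e f c d ihc ihd =>
    intro s
    simp only [run_ite]
    constructor
    · intro v hv
      simp only [vars, List.mem_append, not_or] at hv
      split_ifs
      exacts [(ihc s).var v hv.1, (ihd s).var v hv.2]
    · intro a h
      simp only [arrs, List.mem_append, not_or] at h
      split_ifs
      exacts [(ihc s).arr a h.1, (ihd s).arr a h.2]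
  | loop i e c ih => exact fun s => frame_iterate ih i e s _

/-- The invariant rule for loops. -/
theorem Cmd.run_loop_induction {M : ℕ} {i : V} {e : Expr V A} {c : Cmd V A} {s : Store V A} {N : ℕ}
    (hN : min (e.eval s) M = N) (P : ℕ → Store V A → Prop) (zero : P 0 s)
    (succ : ∀ k < N, ∀ s', (Cmd.loop i e c).Frame s s' → P k s' →
      P (k + 1) (c.run M (s'.setVar i k))) :
    P N ((Cmd.loop i e c).run M s) := by
  have key : ∀ k ≤ N, P k (s.iterate i (c.run M) k) := by
    intro k
    induction k with
    | zero => exact fun _ => zero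
    | succ k ih => exact fun hk => succ k hk _ (frame_iterate (c.frame_run M) i e s k) (ih (by omega))
  simpa only [run, hN] using key N le_rfl

end Reasoning

end RAM

/-! ### The program -/

namespace OutcomeDetermination

open RAM

/-- The variables of the program: the answer `out`; the numbers `issues`, `nodes`, `voters` and the
node `root` of the instance; the reading position `pos`; the quantities `base` and `big` (in the
role of infinity) and the result `res` of the minimization; the optimum `best` without regard to the
partial ballot; and loop variables and intermediate results. -/
inductive Var where
  | out | issues | nodes | root | pos | voters | node | base | big | x | pass | q | j | acc
  | res | voter | issue | y | best
  deriving DecidableEq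

/-- The arrays of the program: the input word, the positions `off` of the labels of the nodes, the
values `val` of the nodes, and for every issue the costs and the weights of its negative and of its
positive literal. -/
inductive Arr where
  | input | off | val | cost0 | cost1 | weight0 | weight1
  deriving DecidableEq

open Var Arr Cmd Expr

/-- Record the position of the label of `node`, and move on to the next label. -/
def skipLabel : Cmd Var Arr := block [
  store off (var node) (var pos),
  ite (get input (var pos)) (lit 2)
    (assign pos (var pos + lit 1))
    (ite (get input (var pos)) (lit 4)
      (assign pos (var pos + lit 2))
      (assign pos (var pos + lit 2 + get input (var pos + lit 1))))]

/-- Find the positions of the labels of the nodes in the input.  At the end, `pos` is the position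
of the first ballot. -/
def parse : Cmd Var Arr := block [
  assign issues (get input (lit 0)),
  assign nodes (get input (lit 1)),
  assign root (get input (lit 2)),
  assign pos (lit 3),
  loop node (var nodes) skipLabel,
  assign voters (get input (var pos)),
  assign pos (var pos + lit 1)]

/-- Recompute the value of a conjunction whose label is at position `q`. -/
def updateAnd : Cmd Var Arr := block [
  assign acc (lit 0),
  loop j (get input (var q + lit 1))
    (assign acc (var acc + get val (get input (var q + lit 2 + var j)))),
  store val (var node) (var acc)]

/-- Recompute the value of a disjunction whose label is at position `q`. -/
def updateOr : Cmd Var Arr := block [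
  assign acc (var big),
  loop j (get input (var q + lit 1))
    (ite (get val (get input (var q + lit 2 + var j))) (var acc)
      (assign acc (get val (get input (var q + lit 2 + var j)))) skip),
  store val (var node) (var acc)]

/-- Recompute the value of a literal whose label is at position `q`.  The costs of the literal and
of its complement are given by the arrays `a` and `a'`. -/
def updateLit (a a' : Arr) : Cmd Var Arr :=
  ite (get input (var q + lit 1)) (var issues)
    (store val (var node) (get a (get input (var q + lit 1)) - get a' (get input (var q + lit 1))))
    (store val (var node) (lit 0))

/-- Recompute the value of a node from the current values of its children. -/
def updateNode : Cmd Var Arr := block [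
  assign q (get off (var node)),
  ite (get input (var q)) (lit 1) (store val (var node) (lit 0))
    (ite (get input (var q)) (lit 2) (store val (var node) (var big))
    (ite (get input (var q)) (lit 3) (updateLit cost1 cost0)
    (ite (get input (var q)) (lit 4) (updateLit cost0 cost1)
    (ite (get input (var q)) (lit 5) updateAnd updateOr))))]

/-- Compute the least cost of a model of the circuit, where the costs of the literals are given by
the arrays `cost0` and `cost1`.  The nodes are not listed bottom-up, but after `k` passes all nodes
with fewer than `k` descendants have the right value. -/
def minCost : Cmd Var Arr := block [
  assign base (lit 0),
  assign big (lit 1),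
  loop x (var issues) (block [
    assign base (var base + (get cost1 (var x) - (get cost1 (var x) - get cost0 (var x)))),
    assign big (var big + (get cost0 (var x) + get cost1 (var x)))]),
  loop pass (var nodes) (loop node (var nodes) updateNode),
  assign res (var base + get val (var root))]

/-- Set the costs for the reversal score of the literal of `issue` that is true in the ballot at
position `pos`. -/
def setReversalCost : Cmd Var Arr := block [
  loop y (var issues)
    (ite (get input (var pos + var y)) (lit 1)
      (block [store cost0 (var y) (lit 0), store cost1 (var y) (lit 1)])
      (block [store cost0 (var y) (lit 1), store cost1 (var y) (lit 0)])),
  ite (get input (var pos + var issue)) (lit 1)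
    (store cost0 (var issue) (var issues + lit 1))
    (store cost1 (var issue) (var issues + lit 1))]

/-- Add the result of the minimization to the weight of the literal of `issue` that is true in the
ballot at position `pos`, unless this literal is true in all rational ballots. -/
def addScore : Cmd Var Arr :=
  ite (var res) (var issues + lit 1)
    (ite (get input (var pos + var issue)) (lit 1)
      (store weight0 (var issue) (get weight0 (var issue) + var res))
      (store weight1 (var issue) (get weight1 (var issue) + var res)))
    skip

/-- Compute the weights of all literals. -/
def computeWeights : Cmd Var Arr :=
  loop voter (var voters) (block [
    loop issue (var issues) (block [setReversalCost, minCost, addScore]),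
    assign pos (var pos + var issues)])

/-- Making a literal true costs the weight of the complementary literal. -/
def setWeightCost : Cmd Var Arr :=
  loop y (var issues) (block [
    store cost0 (var y) (get weight1 (var y)),
    store cost1 (var y) (get weight0 (var y))])

/-- Charge disagreement with the partial ballot at position `pos`. -/
def chargeDisagreement : Cmd Var Arr :=
  loop y (var issues)
    (ite (get input (var pos + var y)) (lit 1)
      (store cost1 (var y) (get cost1 (var y) + lit 1))
      (ite (get input (var pos + var y)) (lit 2)
        (store cost0 (var y) (get cost0 (var y) + lit 1)) skip))

/-- Decide whether charging for disagreement with the partial ballot raises the optimum. -/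
def program : Cmd Var Arr := block [
  parse, computeWeights, setWeightCost, minCost, assign best (var res), chargeDisagreement, minCost,
  ite (var best) (var res) (assign out (lit 0)) (assign out (lit 1))]

end OutcomeDetermination

/-! ### The instance in the store -/

namespace OutcomeDetermination

open RAM
open Var Arr Cmd Expr

/-- The cost of setting the issue `x` to `b`, as given by the cost arrays. -/
def costOf (s : Store Var Arr) (x : ℕ) (b : Bool) : ℕ := bif b then s.arr cost1 x else s.arr cost0 x

/-- The weight of the literal that sets the issue `x` to `b`, as given by the weight arrays. -/
def weightOf (s : Store Var Arr) (x : ℕ) (b : Bool) : ℕ :=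
  bif b then s.arr weight1 x else s.arr weight0 x

/-- The store holds the instance `I`, and the positions of the labels of the nodes are known. -/
structure Parsed (I : DNNFInstance) (s : Store Var Arr) : Prop where
  input : s.arr input = letter I.encode
  issues : s.var issues = I.n
  nodes : s.var nodes = I.Γ.numNodes
  root : s.var root = I.Γ.root
  off : ∀ i, StandsAt I.encode (s.arr off i.val) (DNNFInstance.encodeLabel (I.Γ.label i))

/-- Running a command that does not touch the input and the parsed data preserves them. -/
theorem Parsed.of_frame {I : DNNFInstance} {s s' : Store Var Arr} {c : Cmd Var Arr}
    (h : Parsed I s) (hf : c.Frame s s') (hc : Arr.input ∉ c.arrs ∧ Arr.off ∉ c.arrs ∧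
      Var.issues ∉ c.vars ∧ Var.nodes ∉ c.vars ∧ Var.root ∉ c.vars) : Parsed I s' where
  input := (hf.arr _ hc.1).trans h.input
  issues := (hf.var _ hc.2.2.1).trans h.issues
  nodes := (hf.var _ hc.2.2.2.1).trans h.nodes
  root := (hf.var _ hc.2.2.2.2).trans h.root
  off i := by
    rw [hf.arr _ hc.2.1]
    exact h.off i

theorem Parsed.run {I : DNNFInstance} {s : Store Var Arr} (h : Parsed I s) (M : ℕ)
    (c : Cmd Var Arr) (hc : Arr.input ∉ c.arrs ∧ Arr.off ∉ c.arrs ∧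
      Var.issues ∉ c.vars ∧ Var.nodes ∉ c.vars ∧ Var.root ∉ c.vars) : Parsed I (c.run M s) :=
  h.of_frame (c.frame_run M s) hc

section Encoding

variable (I : DNNFInstance)

/-- The position of the label of the node `k` in the input. -/
def labelPos (k : ℕ) : ℕ :=
  3 + (((List.finRange I.Γ.numNodes).take k).flatMap fun i =>
    DNNFInstance.encodeLabel (I.Γ.label i)).length

theorem labelPos_succ (i : Fin I.Γ.numNodes) :
    labelPos I (i + 1) = labelPos I i + (DNNFInstance.encodeLabel (I.Γ.label i)).length := by
  have : (List.finRange I.Γ.numNodes).take (i + 1) =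
      (List.finRange I.Γ.numNodes).take i ++ [i] := by
    rw [List.take_add_one]
    simp
  simp only [labelPos, this, List.flatMap_append, List.length_append, List.flatMap_singleton]
  omega

theorem length_flatMap_encodeBallot {n : ℕ} (l : List (Ballot n)) :
    (l.flatMap DNNFInstance.encodeBallot).length = l.length * n := by
  simp [List.length_flatMap, DNNFInstance.encodeBallot]

/-- What stands where in the input. -/
theorem encode_spec : letter I.encode 0 = I.n ∧ letter I.encode 1 = I.Γ.numNodes ∧
    letter I.encode 2 = I.Γ.root ∧
    (∀ i, StandsAt I.encode (labelPos I i.val) (DNNFInstance.encodeLabel (I.Γ.label i))) ∧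
    letter I.encode (labelPos I I.Γ.numNodes) = I.profile.length ∧
    (∀ k (hk : k < I.profile.length), StandsAt I.encode
      (labelPos I I.Γ.numNodes + 1 + k * I.n) (DNNFInstance.encodeBallot I.profile[k])) ∧
    StandsAt I.encode (labelPos I I.Γ.numNodes + 1 + I.profile.length * I.n)
      (DNNFInstance.encodePartialBallot I.s) := by
  have h₀ : StandsAt I.encode 0 (I.n :: I.Γ.numNodes :: I.Γ.root.val ::
      (((List.finRange I.Γ.numNodes).flatMap fun i => DNNFInstance.encodeLabel (I.Γ.label i)) ++
        (I.profile.length :: (I.profile.flatMap DNNFInstance.encodeBallot ++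
          DNNFInstance.encodePartialBallot I.s)))) := StandsAt.self _
  have h₁ := h₀.cons
  have h₂ := h₁.2.cons
  have h₃ := h₂.2.cons
  have h₄ := h₃.2.append
  have hpos : labelPos I I.Γ.numNodes = 0 + 1 + 1 + 1 +
      ((List.finRange I.Γ.numNodes).flatMap fun i =>
        DNNFInstance.encodeLabel (I.Γ.label i)).length := by
    rw [labelPos, List.take_of_length_le (by simp)]
  have h₅ := h₄.2.cons
  rw [← hpos] at h₅
  have h₆ := h₅.2.append
  refine ⟨h₁.1, h₂.1, h₃.1, fun i => ?_, h₅.1, fun k hk => ?_, ?_⟩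
  · have := h₄.1.flatMap (k := i) (by simp)
    simpa [labelPos] using this
  · have := h₆.1.flatMap hk
    rwa [length_flatMap_encodeBallot, List.length_take, min_eq_left hk.le] at this
  · have := h₆.2
    rwa [length_flatMap_encodeBallot] at this

theorem issues_le_length : I.n ≤ I.encode.length := by
  have := (encode_spec I).2.2.2.2.2.2.length_le
  simpa [DNNFInstance.encodePartialBallot] using this

theorem nodes_le_length : I.Γ.numNodes ≤ I.encode.length := by
  have h : I.Γ.numNodes ≤ ((List.finRange I.Γ.numNodes).flatMap fun i =>
      DNNFInstance.encodeLabel (I.Γ.label i)).length := by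
    have h₁ : ∀ i : Fin I.Γ.numNodes, 1 ≤ (DNNFInstance.encodeLabel (I.Γ.label i)).length := by
      intro i
      rcases I.Γ.label i with _ | _ | ⟨x, _ | _⟩ | cs | cs <;>
        simp [DNNFInstance.encodeLabel]
    rw [List.length_flatMap]
    calc I.Γ.numNodes = ((List.finRange I.Γ.numNodes).map fun _ => 1).sum := by simp
      _ ≤ _ := List.sum_le_sum fun i _ => h₁ i
  simp only [DNNFInstance.encode, DNNFInstance.encodeCircuit, List.length_cons, List.length_append]
  omega

/-- If there are no issues, then the ballots are empty words, and the number of ballots may well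
exceed the length of the input. -/
theorem voters_le_length (h : 0 < I.n) : I.profile.length ≤ I.encode.length := by
  have : (I.profile.flatMap DNNFInstance.encodeBallot).length ≤ I.encode.length := by
    simp only [DNNFInstance.encode, List.length_cons, List.length_append]
    omega
  rw [length_flatMap_encodeBallot] at this
  exact (Nat.le_mul_of_pos_right _ h).trans this

end Encoding

variable {I : DNNFInstance} {s : Store Var Arr}

theorem run_skipLabel {k : ℕ} (hk : k < I.Γ.numNodes) (hin : s.arr input = letter I.encode)
    (hpos : s.var pos = labelPos I k) (hnode : s.var node = k) (M : ℕ) :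
    (skipLabel.run M s).var pos = labelPos I (k + 1) ∧
      (skipLabel.run M s).arr off = Function.update (s.arr off) k (labelPos I k) := by
  obtain ⟨-, -, -, h₃, -⟩ := encode_spec I
  have hnext := labelPos_succ I ⟨k, hk⟩
  have hat := h₃ ⟨k, hk⟩
  simp only at hnext hat
  rcases hl : I.Γ.label ⟨k, hk⟩ with _ | _ | ⟨x, _ | _⟩ | cs | cs <;>
    rw [hl] at hnext hat <;>
    simp only [DNNFInstance.encodeLabel, List.length_cons, List.length_nil,
      List.length_map] at hnext hat
  · simp [skipLabel, hin, hpos, hnode, hat.cons.1, hnext]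
  · simp [skipLabel, hin, hpos, hnode, hat.cons.1, hnext]
  · simp [skipLabel, hin, hpos, hnode, hat.cons.1, hnext]
  · simp [skipLabel, hin, hpos, hnode, hat.cons.1, hnext]
  · simp [skipLabel, hin, hpos, hnode, hat.cons.1, hat.cons.2.cons.1, hnext]
    omega
  · simp [skipLabel, hin, hpos, hnode, hat.cons.1, hat.cons.2.cons.1, hnext]
    omega

theorem run_parse (I : DNNFInstance) {s' : Store Var Arr}
    (hs' : s' = parse.run I.encode.length (Store.initial input I.encode)) :
    Parsed I s' ∧ s'.var voters = I.profile.length ∧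
      s'.var pos = labelPos I I.Γ.numNodes + 1 ∧ ∀ x b, weightOf s' x b = 0 := by
  obtain ⟨h₀, h₁, h₂, h₃, h₄, -, -⟩ := encode_spec I
  set M := I.encode.length
  set s₀ : Store Var Arr := (block [
    assign issues (get input (lit 0)),
    assign nodes (get input (lit 1)),
    assign root (get input (lit 2)),
    assign pos (lit 3)]).run M (Store.initial input I.encode) with hs₀
  have hin : s₀.arr input = letter I.encode := by
    funext j
    simp [hs₀, Store.initial, letter]
  have hin₀ : (Store.initial input I.encode : Store Var Arr).arr input = letter I.encode := hin
  have hlen : I.Γ.numNodes ≤ M := nodes_le_length I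
  have key := run_loop_induction (M := M) (s := s₀) (i := node) (e := var nodes)
    (c := skipLabel) (N := I.Γ.numNodes) (by simp [hs₀, hin₀, h₁, hlen])
    (fun k s => s.var pos = labelPos I k ∧ ∀ i < k, s.arr off i = labelPos I i)
    ⟨by simp [hs₀, labelPos], by simp⟩
    (by
      rintro k hk s hf ⟨hpos, hoff⟩
      have hrun := run_skipLabel (s := s.setVar node k) hk ((hf.arr _ (by decide)).trans hin)
        (by simp [hpos]) (by simp) M
      refine ⟨hrun.1, fun i hi => ?_⟩
      rw [hrun.2]
      by_cases hik : i = k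
      · simp [hik]
      · simp [hik, hoff i (by omega)])
  have hf := Cmd.frame_run M (loop node (var nodes) skipLabel) s₀
  set s₁ := (loop node (var nodes) skipLabel).run M s₀
  replace hs' : s' = (block [assign voters (get input (var pos)),
      assign pos (var pos + lit 1)]).run M s₁ := hs'
  have hin₁ : s₁.arr input = letter I.encode := (hf.arr _ (by decide)).trans hin
  refine ⟨⟨?_, ?_, ?_, ?_, fun i => ?_⟩, ?_, ?_, ?_⟩
  · simp [hs', hin₁]
  · simp [hs', hf.var issues (by decide), hs₀, hin₀, h₀]
  · simp [hs', hf.var nodes (by decide), hs₀, hin₀, h₁]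
  · simp [hs', hf.var root (by decide), hs₀, hin₀, h₂]
  · simpa [hs', key.2 i i.2] using h₃ i
  · simp [hs', hin₁, key.1, h₄]
  · simp [hs', key.1]
  · intro x b
    have e₀ : s₁.arr weight0 = fun _ => 0 := by
      rw [hf.arr _ (by decide)]
      simp [hs₀, Store.initial]
    have e₁ : s₁.arr weight1 = fun _ => 0 := by
      rw [hf.arr _ (by decide)]
      simp [hs₀, Store.initial]
    cases b <;> simp [weightOf, hs', e₀, e₁]

/-! ### Correctness of the minimization -/

theorem run_updateAnd {w cs : List ℕ} (hin : s.arr input = letter w)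
    (hlen : letter w (s.var q + 1) = cs.length) (hcs : StandsAt w (s.var q + 2) cs) :
    (updateAnd.run w.length s).arr val =
      Function.update (s.arr val) (s.var node) (cs.map (s.arr val)).sum := by
  set s₀ := s.setVar acc 0 with hs₀
  have key := run_loop_induction (M := w.length) (s := s₀) (i := j)
    (e := get input (var q + lit 1))
    (c := assign acc (var acc + get val (get input (var q + lit 2 + var j)))) (N := cs.length)
    (by simp only [hs₀]; simp [hin, hlen, hcs.length_le])
    (fun k s' => s'.var acc = ((cs.take k).map (s.arr val)).sum) (by simp [hs₀])
    (by
      intro k hk s' hf hacc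
      have e₁ : s'.arr input = _ := (hf.arr _ (by decide)).trans hin
      have e₂ : s'.arr val = s.arr val := hf.arr _ (by decide)
      have e₃ : s'.var q = s.var q := (hf.var _ (by decide)).trans (by simp [hs₀])
      rw [List.take_succ_eq_append_getElem hk, List.map_append, List.sum_append, ← hacc]
      simp [e₁, e₂, e₃, hcs.letter_eq hk])
  have hf := Cmd.frame_run w.length (loop j (get input (var q + lit 1))
    (assign acc (var acc + get val (get input (var q + lit 2 + var j))))) s₀
  rw [List.take_length] at key
  simp only [updateAnd, run_block_cons, run_block_nil, run_assign, eval_lit, run_store, eval_var,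
    Store.setArr_arr, if_true, ← hs₀]
  rw [key, hf.arr _ (by decide), hf.var node (by decide)]
  simp [hs₀]

theorem run_updateOr {w cs : List ℕ} (hin : s.arr input = letter w)
    (hlen : letter w (s.var q + 1) = cs.length) (hcs : StandsAt w (s.var q + 2) cs) :
    (updateOr.run w.length s).arr val =
      Function.update (s.arr val) (s.var node) ((cs.map (s.arr val)).foldl min (s.var big)) := by
  set s₀ := s.setVar acc (s.var big) with hs₀
  have key := run_loop_induction (M := w.length) (s := s₀) (i := j)
    (e := get input (var q + lit 1))
    (c := ite (get val (get input (var q + lit 2 + var j))) (var acc)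
      (assign acc (get val (get input (var q + lit 2 + var j)))) skip) (N := cs.length)
    (by simp only [hs₀]; simp [hin, hlen, hcs.length_le])
    (fun k s' => s'.var acc = ((cs.take k).map (s.arr val)).foldl min (s.var big)) (by simp [hs₀])
    (by
      intro k hk s' hf hacc
      have e₁ : s'.arr input = _ := (hf.arr _ (by decide)).trans hin
      have e₂ : s'.arr val = s.arr val := hf.arr _ (by decide)
      have e₃ : s'.var q = s.var q := (hf.var _ (by decide)).trans (by simp [hs₀])
      rw [List.take_succ_eq_append_getElem hk, List.map_append, List.foldl_append, ← hacc]
      simp only [run_ite, eval_get, eval_add, eval_var, eval_lit, Store.setVar_arr,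
        Store.setVar_var, e₁, e₂, e₃, reduceCtorEq, if_false, if_true, hcs.letter_eq hk]
      split_ifs with hlt
      · simp [e₁, e₂, e₃, hcs.letter_eq hk, hlt.le]
      · simp [not_lt.1 hlt])
  have hf := Cmd.frame_run w.length (loop j (get input (var q + lit 1))
    (ite (get val (get input (var q + lit 2 + var j))) (var acc)
      (assign acc (get val (get input (var q + lit 2 + var j)))) skip)) s₀
  rw [List.take_length] at key
  simp only [updateOr, run_block_cons, run_block_nil, run_assign, run_store, eval_var,
    Store.setArr_arr, if_true, ← hs₀]
  rw [key, hf.arr _ (by decide), hf.var node (by decide)]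
  simp [hs₀]

theorem run_updateNode (h : Parsed I s) {i : Fin I.Γ.numNodes} (hi : s.var node = i) :
    (updateNode.run I.encode.length s).arr val = Function.update (s.arr val) i
      (Circuit.nodeCost I.n (costOf s) (s.var big) (fun j => s.arr val j) (I.Γ.label i)) := by
  have hat := h.off i
  set s₀ := s.setVar q (s.arr off i) with hs₀
  have hin : s₀.arr input = letter I.encode := h.input
  have hq : s₀.var q = s.arr off i := by simp [hs₀]
  simp only [updateNode, run_block_cons, run_block_nil, run_assign, eval_get, eval_var, hi, ← hs₀,
    run_ite, eval_lit, hin, hq]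
  rcases hl : I.Γ.label i with _ | _ | ⟨x, _ | _⟩ | cs | cs <;> rw [hl] at hat <;>
    simp only [DNNFInstance.encodeLabel] at hat <;> have h₁ := hat.cons.1
  · simp [h₁, hs₀, hi, Circuit.nodeCost]
  · simp [h₁, hs₀, hi, Circuit.nodeCost]
  · have h₂ := hat.cons.2.cons.1
    by_cases hx : x < I.n <;>
      simp [h₁, h₂, hs₀, hi, Circuit.nodeCost, updateLit, h.input, h.issues, hx, relCost, costOf]
  · have h₂ := hat.cons.2.cons.1
    by_cases hx : x < I.n <;>
      simp [h₁, h₂, hs₀, hi, Circuit.nodeCost, updateLit, h.input, h.issues, hx, relCost, costOf]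
  · have := run_updateAnd (s := s₀) (cs := cs.map Fin.val) hin
      (by rw [hq, hat.cons.2.cons.1, List.length_map]) (by rw [hq]; exact hat.cons.2.cons.2)
    rw [h₁]
    simp only [Nat.reduceLT, if_false, if_true, this]
    simp [hs₀, hi, Circuit.nodeCost, Function.comp_def]
  · have := run_updateOr (s := s₀) (cs := cs.map Fin.val) hin
      (by rw [hq, hat.cons.2.cons.1, List.length_map]) (by rw [hq]; exact hat.cons.2.cons.2)
    rw [h₁]
    simp only [Nat.reduceLT, if_false, this]
    simp [hs₀, hi, Circuit.nodeCost, Function.comp_def]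

/-- The program computes the least cost of a model.  After `k` passes, the values of the nodes of
rank less than `k` are right: a node is recomputed when its children, which have smaller rank, already
are. -/
theorem run_minCost (h : Parsed I s) (hsat : ∃ α, I.Γ.Sat α) :
    IsLeast {m | ∃ α, I.Γ.Sat α ∧ assignmentCost I.n (costOf s) α = m}
      ((minCost.run I.encode.length s).var res) := by
  have hn := issues_le_length I
  have hN := nodes_le_length I
  set M := I.encode.length
  set c := costOf s with hc
  obtain ⟨rank, rank_lt, rank_arc⟩ := Circuit.exists_rank I.isDNNF.acyclic
  -- the base cost and the value for infinity
  set cx : Cmd Var Arr := loop x (var issues) (block [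
    assign base (var base + (get cost1 (var x) - (get cost1 (var x) - get cost0 (var x)))),
    assign big (var big + (get cost0 (var x) + get cost1 (var x)))]) with hcx
  set s₀ := (s.setVar base 0).setVar big 1 with hs₀
  have key₁ := run_loop_induction (M := M) (s := s₀) (i := x) (e := var issues) (c := block [
      assign base (var base + (get cost1 (var x) - (get cost1 (var x) - get cost0 (var x)))),
      assign big (var big + (get cost0 (var x) + get cost1 (var x)))]) (N := I.n)
    (by simp [hs₀, h.issues, hn])
    (fun k s' => s'.var base = baseCost k c ∧
      s'.var big = 1 + ∑ x ∈ Finset.range k, (c x false + c x true))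
    (by simp [hs₀, baseCost])
    (by
      rintro k hk s' hf ⟨hbase, hbig⟩
      have e₁ : s'.arr cost0 = s.arr cost0 := hf.arr _ (by decide)
      have e₂ : s'.arr cost1 = s.arr cost1 := hf.arr _ (by decide)
      constructor
      · rw [baseCost, Finset.sum_range_succ, ← baseCost]
        simp [hbase, e₁, e₂, hc, costOf]
      · rw [Finset.sum_range_succ, ← add_assoc]
        simp [hbig, e₁, e₂, hc, costOf])
  have hf₁ := cx.frame_run M s₀
  set s₁ := cx.run M s₀ with hs₁
  have hp₁ : Parsed I s₁ := by
    refine Parsed.of_frame (c := block [assign base (lit 0), assign big (lit 1), cx]) h ?_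
      (by decide)
    exact Cmd.frame_run M _ s
  have hc₁ : costOf s₁ = c := by
    funext x b
    have e₁ : s₁.arr cost0 = s.arr cost0 := hf₁.arr _ (by decide)
    have e₂ : s₁.arr cost1 = s.arr cost1 := hf₁.arr _ (by decide)
    simp [costOf, hc, e₁, e₂]
  set K := s₁.var big
  have hbig : ∀ α, assignmentCost I.n (relCost c) α < K := by
    intro α
    rw [key₁.2, Nat.lt_one_add_iff]
    refine Finset.sum_le_sum fun x _ => (Nat.sub_le _ _).trans ?_
    cases α x <;> simp
  -- the passes over the nodes
  have key₂ := run_loop_induction (M := M) (s := s₁) (i := pass) (e := var nodes)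
    (c := loop node (var nodes) updateNode) (N := I.Γ.numNodes) (by simp [hp₁.nodes, hN])
    (fun k s' => ∀ i, rank i < k → I.Γ.IsLeastCost I.n c K i (s'.arr val i))
    (by simp)
    (by
      intro k hk s₂ hf₂ hs₂
      have hf₂' := hf₂.setVar_left (i := pass) (k := k) (var nodes)
      have hnodes : (s₂.setVar pass k).var nodes = I.Γ.numNodes :=
        (hf₂'.var _ (by decide)).trans hp₁.nodes
      have key := run_loop_induction (M := M) (s := s₂.setVar pass k) (i := node)
        (e := var nodes) (c := updateNode) (N := I.Γ.numNodes)
        (by rw [eval_var, hnodes, min_eq_left hN])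
        (fun l s' => ∀ i, (rank i < k ∨ rank i < k + 1 ∧ i.val < l) →
          I.Γ.IsLeastCost I.n c K i (s'.arr val i))
        (by simpa using hs₂)
        (by
          intro l hl s₃ hf₃ hs₃ i hi
          have hf₃' := hf₃.setVar_left (i := node) (k := l) (var nodes)
          have hp₃ : Parsed I (s₃.setVar node l) :=
            (hp₁.of_frame hf₂' (by decide)).of_frame hf₃' (by decide)
          have hc₃ : costOf (s₃.setVar node l) = c := by
            rw [← hc₁]
            funext x b
            simp only [costOf]
            rw [hf₃'.arr cost0 (by decide), hf₃'.arr cost1 (by decide),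
              hf₂'.arr cost0 (by decide), hf₂'.arr cost1 (by decide)]
          have hbig₃ : (s₃.setVar node l).var big = K := by
            rw [hf₃'.var big (by decide), hf₂'.var big (by decide)]
          have hrun := run_updateNode hp₃ (i := ⟨l, hl⟩) (by simp)
          rw [hc₃, hbig₃] at hrun
          rw [hrun]
          by_cases hil : i.val = l
          · obtain rfl : i = ⟨l, hl⟩ := Fin.ext hil
            rw [Function.update_self]
            refine Circuit.isLeastCost_nodeCost I.isDNNF fun j hj => hs₃ j (Or.inl ?_)
            have := rank_arc _ _ hj
            omega
          · rw [Function.update_of_ne hil]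
            exact hs₃ i (by omega))
      intro i hi
      exact key i (Or.inr ⟨hi, i.2⟩))
  have hf₂ := Cmd.frame_run M (loop pass (var nodes) (loop node (var nodes) updateNode)) s₁
  have hroot := (key₂ I.Γ.root (rank_lt _)).isLeast hsat hbig
  rw [← key₁.1] at hroot
  have hres : (minCost.run M s).var res =
      ((loop pass (var nodes) (loop node (var nodes) updateNode)).run M s₁).var base +
      ((loop pass (var nodes) (loop node (var nodes) updateNode)).run M s₁).arr val
        (((loop pass (var nodes) (loop node (var nodes) updateNode)).run M s₁).var root) := rfl
  rw [hres, hf₂.var base (by decide), hf₂.var root (by decide), hp₁.root]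
  exact hroot

end OutcomeDetermination

namespace OutcomeDetermination

open RAM
open Var Arr Cmd Expr

variable {I : DNNFInstance} {s : Store Var Arr}

/-! ### Correctness of the weights -/

theorem letter_encodeBallot {w : List ℕ} {k n : ℕ} {r : Ballot n}
    (h : StandsAt w k (DNNFInstance.encodeBallot r)) (x : Fin n) :
    letter w (k + x) = (r x).toNat := by
  rw [h.letter_eq (by simp [DNNFInstance.encodeBallot])]
  simp [DNNFInstance.encodeBallot]

theorem letter_encodePartialBallot {w : List ℕ} {k n : ℕ} {p : PartialBallot n}
    (h : StandsAt w k (DNNFInstance.encodePartialBallot p)) (x : Fin n) :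
    letter w (k + x) = (p x).elim 2 Bool.toNat := by
  rw [h.letter_eq (by simp [DNNFInstance.encodePartialBallot])]
  simp only [DNNFInstance.encodePartialBallot, List.getElem_map, List.getElem_finRange]
  rcases hp : p x with _ | b <;> simp [hp]

theorem run_setReversalCost (h : Parsed I s) {r : Ballot I.n}
    (hr : StandsAt I.encode (s.var pos) (DNNFInstance.encodeBallot r)) {x : Fin I.n}
    (hx : s.var issue = x) (y : Fin I.n) (b : Bool) :
    costOf (setReversalCost.run I.encode.length s) y b = reversalCost r x y b := by
  have hn := issues_le_length I
  set M := I.encode.length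
  have key := run_loop_induction (M := M) (s := s) (i := Var.y) (e := var issues)
    (c := ite (get input (var pos + var Var.y)) (lit 1)
      (block [store cost0 (var Var.y) (lit 0), store cost1 (var Var.y) (lit 1)])
      (block [store cost0 (var Var.y) (lit 1), store cost1 (var Var.y) (lit 0)])) (N := I.n)
    (by simp [h.issues, hn])
    (fun k s' => ∀ y : Fin I.n, y.val < k → ∀ b, costOf s' y b = if b = r y then 0 else 1)
    (by simp)
    (by
      intro k hk s' hf hs' y hy b
      have e₁ : s'.arr input = _ := (hf.arr _ (by decide)).trans h.input
      have e₂ : s'.var pos = s.var pos := hf.var _ (by decide)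
      have e₃ := letter_encodeBallot hr ⟨k, hk⟩
      simp only at e₃
      by_cases hyk : y.val = k
      · obtain rfl : y = ⟨k, hk⟩ := Fin.ext hyk
        cases hb : r ⟨k, hk⟩ <;> rw [hb] at e₃ <;> cases b <;> simp [costOf, e₁, e₂, e₃]
      · rw [← hs' y (by omega) b]
        cases hb : r ⟨k, hk⟩ <;> rw [hb] at e₃ <;> cases b <;> simp [costOf, e₁, e₂, e₃, hyk])
  have hf := Cmd.frame_run M (loop Var.y (var issues)
    (ite (get input (var pos + var Var.y)) (lit 1)
      (block [store cost0 (var Var.y) (lit 0), store cost1 (var Var.y) (lit 1)])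
      (block [store cost0 (var Var.y) (lit 1), store cost1 (var Var.y) (lit 0)]))) s
  rw [setReversalCost, run_block_cons]
  set s₁ := (loop Var.y (var issues)
    (ite (get input (var pos + var Var.y)) (lit 1)
      (block [store cost0 (var Var.y) (lit 0), store cost1 (var Var.y) (lit 1)])
      (block [store cost0 (var Var.y) (lit 1), store cost1 (var Var.y) (lit 0)]))).run M s
  have e₁ : s₁.arr input = _ := (hf.arr _ (by decide)).trans h.input
  have e₂ : s₁.var pos = s.var pos := hf.var _ (by decide)
  have e₃ := letter_encodeBallot hr x
  have e₄ : s₁.var issue = x := (hf.var _ (by decide)).trans hx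
  have e₅ : s₁.var issues = I.n := (hf.var _ (by decide)).trans h.issues
  have hy := key y y.2 b
  simp only [reversalCost, ← hy]
  by_cases hyx : y = x
  · subst hyx
    cases hb : r y <;> rw [hb] at e₃ <;> cases b <;> simp [costOf, e₁, e₂, e₃, e₄, e₅]
  · have : y.val ≠ x.val := fun h => hyx (Fin.ext h)
    cases hb : r x <;> rw [hb] at e₃ <;> cases b <;>
      simp [costOf, e₁, e₂, e₃, e₄, e₅, hyx, this]

/-- One round of the inner loop treats the literal of the issue `x` that is true in the ballot `r`.
The score of the complementary literal is `0` because `r` itself is rational. -/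
theorem run_issueStep (h : Parsed I s) {r : Ballot I.n} (hrat : r ∈ rationalBallots I.n I.Γ)
    (hr : StandsAt I.encode (s.var pos) (DNNFInstance.encodeBallot r)) {x : Fin I.n}
    (hx : s.var issue = x) (y : Fin I.n) (b : Bool) :
    weightOf ((block [setReversalCost, minCost, addScore]).run I.encode.length s) y b =
      weightOf s y b +
        if y = x then reversalScore (rationalBallots I.n I.Γ) r (x, b) else 0 := by
  obtain ⟨α, -, hα⟩ := id hrat
  set M := I.encode.length with hM
  set s₁ := setReversalCost.run M s with hs₁
  have hmin := isLeast_rationalBallots (run_minCost (h.run M setReversalCost (by decide)) ⟨α, hα⟩)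
  rw [← hM, ← hs₁] at hmin
  simp only [hs₁, hM, run_setReversalCost h hr hx] at hmin
  rw [← hM, ← hs₁] at hmin
  have hf₁ := Cmd.frame_run M setReversalCost s
  rw [← hs₁] at hf₁
  have hf₂ := Cmd.frame_run M minCost s₁
  have hw : ∀ b, weightOf (minCost.run M s₁) y b = weightOf s y b := by
    intro b
    simp only [weightOf]
    rw [hf₂.arr weight0 (by decide), hf₂.arr weight1 (by decide), hf₁.arr weight0 (by decide),
      hf₁.arr weight1 (by decide)]
  rw [run_block_cons, run_block_cons, run_block_cons, run_block_nil, ← hs₁, ← hw]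
  set s₂ := minCost.run M s₁
  have e₁ : s₂.arr input = _ :=
    (hf₂.arr _ (by decide)).trans ((hf₁.arr _ (by decide)).trans h.input)
  have e₂ : s₂.var pos = s.var pos := (hf₂.var _ (by decide)).trans (hf₁.var _ (by decide))
  have e₃ := letter_encodeBallot hr x
  have e₄ : s₂.var issue = x :=
    (hf₂.var _ (by decide)).trans ((hf₁.var _ (by decide)).trans hx)
  have e₅ : s₂.var issues = I.n :=
    (hf₂.var _ (by decide)).trans ((hf₁.var _ (by decide)).trans h.issues)
  have hscore := reversalScore_of_val_eq hmin
  by_cases hyx : y = x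
  · subst hyx
    rw [if_pos rfl]
    by_cases hb : b = r y
    · subst hb
      rw [hscore]
      by_cases hlt : s₂.var res < I.n + 1 <;> cases hb : r y <;> rw [hb] at e₃ <;>
        simp [addScore, weightOf, e₁, e₂, e₃, e₄, e₅, hlt]
    · rw [reversalScore_of_val_ne hrat hb]
      obtain rfl : b = !r y := Bool.eq_not.2 hb
      by_cases hlt : s₂.var res < I.n + 1 <;> cases hb : r y <;> rw [hb] at e₃ <;>
        simp [addScore, weightOf, e₁, e₂, e₃, e₄, e₅, hlt]
  · have hne : y.val ≠ x.val := fun h => hyx (Fin.ext h)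
    by_cases hlt : s₂.var res < I.n + 1 <;> cases hb : r x <;> rw [hb] at e₃ <;> cases b <;>
      simp [addScore, weightOf, e₁, e₂, e₃, e₄, e₅, hlt, hyx, hne]

theorem run_issueLoop (h : Parsed I s) {r : Ballot I.n} (hrat : r ∈ rationalBallots I.n I.Γ)
    (hr : StandsAt I.encode (s.var pos) (DNNFInstance.encodeBallot r)) (y : Fin I.n) (b : Bool) :
    weightOf ((loop issue (var issues) (block [setReversalCost, minCost, addScore])).run
      I.encode.length s) y b =
      weightOf s y b + reversalScore (rationalBallots I.n I.Γ) r (y, b) := by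
  have hn := issues_le_length I
  have key := run_loop_induction (M := I.encode.length) (s := s) (i := issue) (e := var issues)
    (c := block [setReversalCost, minCost, addScore]) (N := I.n) (by simp [h.issues, hn])
    (fun k s' => ∀ (y : Fin I.n) b, weightOf s' y b = weightOf s y b +
      if y.val < k then reversalScore (rationalBallots I.n I.Γ) r (y, b) else 0)
    (by simp)
    (by
      intro k hk s' hf hs' y b
      have hf' := hf.setVar_left (i := issue) (k := k) (var issues)
      have hp := h.of_frame hf' (by decide)
      rw [run_issueStep hp hrat (by rwa [hf'.var pos (by decide)]) (x := ⟨k, hk⟩) (by simp)]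
      have : weightOf (s'.setVar issue k) y b = weightOf s' y b := rfl
      rw [this, hs', add_assoc]
      congr 1
      by_cases hyk : y.val = k
      · obtain rfl : y = ⟨k, hk⟩ := Fin.ext hyk
        simp
      · have hne : y ≠ ⟨k, hk⟩ := fun h => hyk (congrArg Fin.val h)
        simp only [hne, if_false, add_zero]
        congr 1
        exact propext (by omega))
  rw [key y b, if_pos y.2]

theorem run_computeWeights (h : Parsed I s) (hv : s.var voters = I.profile.length)
    (hpos : s.var pos = labelPos I I.Γ.numNodes + 1) (hw : ∀ x b, weightOf s x b = 0) :
    StandsAt I.encode ((computeWeights.run I.encode.length s).var pos)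
        (DNNFInstance.encodePartialBallot I.s) ∧
      ∀ (y : Fin I.n) b, weightOf (computeWeights.run I.encode.length s) y b =
        literalWeight (rationalBallots I.n I.Γ) I.profile y b := by
  obtain ⟨-, -, -, -, -, hballots, hpartial⟩ := encode_spec I
  have key := run_loop_induction (M := I.encode.length) (s := s) (i := voter) (e := var voters)
    (c := block [
      loop issue (var issues) (block [setReversalCost, minCost, addScore]),
      assign pos (var pos + var issues)]) rfl
    (fun k s' => s'.var pos = labelPos I I.Γ.numNodes + 1 + k * I.n ∧
      ∀ (y : Fin I.n) b, weightOf s' y b =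
        literalWeight (rationalBallots I.n I.Γ) (I.profile.take k) y b)
    (by simp [hpos, hw, literalWeight])
    (by
      rintro k hk s' hf ⟨hpos', hw'⟩
      have hk' : k < I.profile.length := by
        rw [← hv]
        exact hk.trans_le (min_le_left _ _)
      have hf' := hf.setVar_left (i := voter) (k := k) (var voters)
      have hp := h.of_frame hf' (by decide)
      have hpos'' : (s'.setVar voter k).var pos = labelPos I I.Γ.numNodes + 1 + k * I.n := by
        simp [hpos']
      have hf₁ := Cmd.frame_run I.encode.length
        (loop issue (var issues) (block [setReversalCost, minCost, addScore]))
        (s'.setVar voter k)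
      constructor
      · rw [run_block_cons, run_block_cons, run_block_nil]
        simp only [run_assign, eval_add, eval_var, Store.setVar_var, if_true]
        rw [hf₁.var pos (by decide), hf₁.var issues (by decide), hpos'', hp.issues]
        ring
      · intro y b
        have := run_issueLoop hp (I.profile_rational _ (List.getElem_mem hk'))
          (by rw [hpos'']; exact hballots k hk') y b
        rw [run_block_cons, run_block_cons, run_block_nil]
        refine this.trans ?_
        have e : weightOf (s'.setVar voter k) y b = weightOf s' y b := rfl
        rw [e, hw', literalWeight, literalWeight, List.take_succ_eq_append_getElem hk',
          List.map_append, List.sum_append, List.map_singleton, List.sum_singleton])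
  change (computeWeights.run I.encode.length s).var pos = _ ∧ ∀ (y : Fin I.n) b,
    weightOf (computeWeights.run I.encode.length s) y b = _ at key
  -- the rounds may fall short of the number of ballots only if there are no issues
  rcases Nat.eq_zero_or_pos I.n with h0 | h0
  · refine ⟨?_, fun y => absurd y.2 (by omega)⟩
    have e : ∀ m, m * I.n = 0 := fun m => by rw [h0, mul_zero]
    rw [e] at hpartial
    rwa [key.1, e]
  · have : min ((var voters : Expr Var Arr).eval s) I.encode.length = I.profile.length := by
      rw [eval_var, hv, min_eq_left (voters_le_length I h0)]
    rw [this, List.take_length] at key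
    refine ⟨?_, key.2⟩
    rw [key.1]
    exact hpartial

/-! ### Correctness of the answer -/

theorem run_setWeightCost (h : Parsed I s) (y : Fin I.n) (b : Bool) :
    costOf (setWeightCost.run I.encode.length s) y b = weightOf s y (!b) := by
  have hn := issues_le_length I
  have key := run_loop_induction (M := I.encode.length) (s := s) (i := Var.y) (e := var issues)
    (c := block [
      store cost0 (var Var.y) (get weight1 (var Var.y)),
      store cost1 (var Var.y) (get weight0 (var Var.y))]) (N := I.n)
    (by simp [h.issues, hn])
    (fun k s' => ∀ y < k, ∀ b, costOf s' y b = weightOf s y (!b))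
    (by simp)
    (by
      intro k hk s' hf hs' y hy b
      have e₁ : s'.arr weight0 = s.arr weight0 := hf.arr _ (by decide)
      have e₂ : s'.arr weight1 = s.arr weight1 := hf.arr _ (by decide)
      by_cases hyk : y = k
      · cases b <;> simp [costOf, weightOf, hyk, e₁, e₂]
      · rw [← hs' y (by omega) b]
        cases b <;> simp [costOf, hyk])
  exact key y y.2 b

theorem run_chargeDisagreement (h : Parsed I s)
    (hs : StandsAt I.encode (s.var pos) (DNNFInstance.encodePartialBallot I.s)) (y : Fin I.n)
    (b : Bool) : costOf (chargeDisagreement.run I.encode.length s) y b =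
      costOf s y b + if I.s y = some (!b) then 1 else 0 := by
  have hn := issues_le_length I
  have key := run_loop_induction (M := I.encode.length) (s := s) (i := Var.y) (e := var issues)
    (c := ite (get input (var pos + var Var.y)) (lit 1)
      (store cost1 (var Var.y) (get cost1 (var Var.y) + lit 1))
      (ite (get input (var pos + var Var.y)) (lit 2)
        (store cost0 (var Var.y) (get cost0 (var Var.y) + lit 1)) skip)) (N := I.n)
    (by simp [h.issues, hn])
    (fun k s' => ∀ (y : Fin I.n) b, costOf s' y b = costOf s y b +
      if y.val < k ∧ I.s y = some (!b) then 1 else 0)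
    (by simp)
    (by
      intro k hk s' hf hs' y b
      have e₁ : s'.arr input = _ := (hf.arr _ (by decide)).trans h.input
      have e₂ : s'.var pos = s.var pos := hf.var _ (by decide)
      have e₃ := letter_encodePartialBallot hs ⟨k, hk⟩
      simp only at e₃
      have e₄ := hs' y b
      by_cases hyk : y.val = k
      · obtain rfl : y = ⟨k, hk⟩ := Fin.ext hyk
        rcases hsk : I.s ⟨k, hk⟩ with _ | _ | _ <;> rw [hsk] at e₃ e₄ <;> cases b <;>
          simp_all [costOf]
      · have hlt : y.val < k + 1 ↔ y.val < k := by omega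
        simp only [hlt]
        rw [← e₄]
        rcases hsk : I.s ⟨k, hk⟩ with _ | _ | _ <;> rw [hsk] at e₃ <;> cases b <;>
          simp [costOf, e₁, e₂, e₃, hyk])
  refine (key y b).trans ?_
  simp

theorem run_program (I : DNNFInstance) :
    (I.IsYes →
      (program.run I.encode.length (Store.initial input I.encode)).var out = 1) ∧
    (¬ I.IsYes →
      (program.run I.encode.length (Store.initial input I.encode)).var out = 0) := by
  obtain ⟨r, hr⟩ := List.exists_mem_of_ne_nil _ I.profile_ne_nil
  obtain ⟨α, -, hα⟩ := I.profile_rational r hr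
  have hsat : ∃ α, I.Γ.Sat α := ⟨α, hα⟩
  set M := I.encode.length with hM
  obtain ⟨hp₁, hv, hpos, hw⟩ := run_parse I rfl
  rw [← hM] at hp₁ hv hpos hw
  set s₁ := parse.run M (Store.initial input I.encode)
  obtain ⟨hs₂, hw₂⟩ := run_computeWeights hp₁ hv hpos hw
  rw [← hM] at hs₂ hw₂
  have hp₂ := hp₁.run M computeWeights (by decide)
  set s₂ := computeWeights.run M s₁
  have hc₃ := run_setWeightCost hp₂
  rw [← hM] at hc₃
  have hp₃ := hp₂.run M setWeightCost (by decide)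
  have hf₃ := Cmd.frame_run M setWeightCost s₂
  set s₃ := setWeightCost.run M s₂
  have hmin₃ := isLeast_rationalBallots (run_minCost hp₃ hsat)
  rw [← hM] at hmin₃
  have hp₄ := hp₃.run M minCost (by decide)
  have hf₄ := Cmd.frame_run M minCost s₃
  set s₄ := minCost.run M s₃
  set s₅ := s₄.setVar best (s₄.var res) with hs₅
  have hp₅ : Parsed I s₅ := hp₄.run M (assign best (var res)) (by decide)
  have hc₅ : ∀ y b, costOf s₅ y b = costOf s₃ y b := by
    intro y b
    simp only [costOf, hs₅, Store.setVar_arr]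
    rw [hf₄.arr cost0 (by decide), hf₄.arr cost1 (by decide)]
  have hpos₅ : s₅.var pos = s₂.var pos := by
    simp only [hs₅, Store.setVar_var, reduceCtorEq, if_false]
    rw [hf₄.var pos (by decide), hf₃.var pos (by decide)]
  have hc₆ := run_chargeDisagreement hp₅ (by rwa [hpos₅])
  rw [← hM] at hc₆
  have hp₆ := hp₅.run M chargeDisagreement (by decide)
  have hf₆ := Cmd.frame_run M chargeDisagreement s₅
  set s₆ := chargeDisagreement.run M s₅
  have hmin₆ := isLeast_rationalBallots (run_minCost hp₆ hsat)
  rw [← hM] at hmin₆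
  have hf₇ := Cmd.frame_run M minCost s₆
  simp only [hc₆, hc₅, hc₃, hw₂] at hmin₃ hmin₆
  have hiff := exists_agrees_iff hmin₃ hmin₆
  have hbest : (minCost.run M s₆).var best = s₄.var res := by
    rw [hf₇.var best (by decide), hf₆.var best (by decide)]
    simp [hs₅]
  have hrun : program.run M (Store.initial input I.encode) =
      (ite (var best) (var res) (assign out (lit 0)) (assign out (lit 1))).run M
        (minCost.run M s₆) := rfl
  rw [hrun, run_ite, eval_var, eval_var, hbest, DNNFInstance.IsYes, hiff, not_not]
  exact ⟨fun h => by simp [h], fun h => by simp [h]⟩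

end OutcomeDetermination

theorem mainTheorem5 :
    RAM.DecidableInPolyTime DNNFInstance.encode DNNFInstance.IsYes := by
  have hv : Function.Injective OutcomeDetermination.Var.ctorIdx := by
    intro a b h
    cases a <;> cases b <;> first | rfl | cases h
  have ha : Function.Injective OutcomeDetermination.Arr.ctorIdx := by
    intro a b h
    cases a <;> cases b <;> first | rfl | cases h
  exact RAM.decidableInPolyTime_of_cmd hv ha (input := .input) rfl .out
    OutcomeDetermination.program _ _ (fun I => (OutcomeDetermination.run_program I).1)
    (fun I => (OutcomeDetermination.run_program I).2)
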